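/- Let $X$ be a second-countable locally compact Hausdorff space. Write $\mathfrak M^+$ for the cone of positive Radon measures on $X$. Let $\kappa:X\times X\to[0,\infty]$ be a kernel, i.e. a symmetric lower semicontinuous function. For $\mu,\nu\in\mathfrak M^+$ put $U^\mu(x):=\int\kappa(x,y)\,d\mu(y)$, $I(\mu,\nu):=\int\kappa\,d(\mu\otimes\nu)$, $I(\mu):=I(\mu,\mu)$, and let $\mathcal E^+:=\{\mu\in\mathfrak M^+: I(\mu)<\infty\}$. For $A\subset X$ let $\mathcal E^+(A)$ be the set of $\mu\in\mathcal E^+$ for which $X\setminus A$ is $\mu$-negligible. Assume: * $\kappa$ is perfect. That is, it satisfies the energy principle ($I(\mu)\geqslant0$ for every signed Radon measure $\mu$ whose energy is defined, with $I(\mu)=0$ only for $\mu=0$), so that signed Radon measures of finite energy form a pre-Hilbert space with norm $\|\mu\|=\sqrt{I(\mu)}$, whose topology is called strong. It also satisfies the consistency principle: $\mathcal E^+$ is strongly complete, and on $\mathcal E^+$ the strong topology is finer than the vague one. * Domination principle: if $\mu\in\mathcal E^+$, $\nu\in\mathfrak M^+$ and $U^\mu\leqslant U^\nu$ $\mu$-a.e.,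 then $U^\mu\leqslant U^\nu$ on $X$. * Ugaheri maximum principle: there is $M\in[1,\infty)$ such that if $\mu\in\mathcal E^+$, $c\in(0,\infty)$ and $U^\mu\leqslant c$ $\mu$-a.e., then $U^\mu\leqslant Mc$ on $X$. For compact $K$ let $c(K):=1/\inf I(\mu)$, the infimum being over all $\mu\in\mathfrak M^+$ concentrated on $K$ with $\mu(X)=1$. Let $c_*(A):=\sup\{c(K): K\subset A\text{ compact}\}$ be the inner capacity. A property holds nearly everywhere (n.e.) on $A$ if the set of points of $A$ where it fails has inner capacity $0$. Let $A\subset X$ be such that $c_*(A)>0$ and $\mathcal E^+(A)$ is strongly closed. Let $\omega\in\mathfrak M^+$, $\omega\ne0$, be such that either $\omega\in\mathcal E^+$, or $\omega(X)<\infty$, $\sup_AU^\omega<\infty$, and $U^\omega|_K$ is continuous for every compact $K\subset A$. Put $f:=-U^\omega$, let $\mathcal E_f^+(A)$ be the set of all $\mu\in\mathcal E^+(A)$ for which $f$ is $\mu$-integrable, let $I_f(\mu):=\|\mu\|^2+2\int f\,d\mu$ for such $\mu$, let $\widehat w_f(A):=\inf_{\mu\in\mathcal E^+_f(A)}I_f(\mu)$,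 and let $\Gamma_{A,\omega}:=\{\nu\in\mathfrak M^+: U^\nu\geqslant U^\omega\text{ n.e. on }A\}$. **Theorem 1.1.** For every $\sigma\in\mathcal E^+$ there is exactly one $\sigma^A\in\mathcal E^+(A)$ with $U^{\sigma^A}=U^\sigma$ n.e. on $A$. For every compact $K\subset A$ there is exactly one $\omega^K\in\mathcal E^+(K)$ with $U^{\omega^K}=U^\omega$ n.e. on $K$. There is one and the same measure $\omega^A$, called the inner balayage of $\omega$ onto $A$, that is uniquely characterized by any one of the following (i)–(vi). (i) $\omega^A$ is the only measure in $\mathcal E^+(A)$ with $U^{\omega^A}=U^\omega$ n.e. on $A$; equivalently, the only measure in $\mathcal E^+(A)$ with $\int U^{\omega^A}\,d\mu=\int U^\omega\,d\mu$ for all $\mu\in\mathcal E^+(A)$. (ii) $\omega^A$ is the only measure in $\mathcal E^+(A)$ with $\int U^{\omega^A}\,d\sigma=\int U^\omega\,d\sigma^A$ for all $\sigma\in\mathcal E^+$. (iii) $\omega^A$ is uniquely determined within $\mathcal E^+(A)$ by any one of the following limit relations along the upward directed set of compact $K\subset A$: $\omega^K\to\omega^A$ strongly; $\omega^K\to\omega^A$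 vaguely; $U^{\omega^K}\uparrow U^{\omega^A}$ pointwise on $X$. (iv) $\omega^A$ is the unique measure in $\mathcal E^+_f(A)$ minimizing $I_f$ over $\mathcal E^+_f(A)$, and $I_f(\omega^A)=\widehat w_f(A)\in(-\infty,0]$. (v) $\omega^A$ is the only measure in $\Gamma_{A,\omega}\cap\mathcal E^+$ with $U^{\omega^A}=\min_{\nu\in\Gamma_{A,\omega}}U^\nu$ on $X$. (vi) $\omega^A$ is the only measure in $\Gamma_{A,\omega}\cap\mathcal E^+$ with $I(\omega^A)=\min_{\nu\in\Gamma_{A,\omega}}I(\nu)$. -/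

import Mathlib

open MeasureTheory Filter Topology Set
open scoped ENNReal

namespace Balayage

variable {X : Type*} [TopologicalSpace X] [MeasurableSpace X]

/-- The cone of positive Radon measures: Borel measures finite on compact sets. (On a
second-countable locally compact Hausdorff space all such measures are regular.) -/
def RadonPos (X : Type*) [TopologicalSpace X] [MeasurableSpace X] : Set (Measure X) :=
  {μ | IsFiniteMeasureOnCompacts μ}

/-- A kernel: a symmetric, lower semicontinuous function `X × X → [0, ∞]`. -/
structure IsKernel (κ : X → X → ℝ≥0∞) : Prop where
  symm : ∀ x y, κ x y = κ y x
  lsc : LowerSemicontinuous fun p : X × X => κ p.1 p.2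

/-- The potential `U^μ (x) = ∫ κ(x, y) dμ(y)` of a positive measure. -/
noncomputable def potential (κ : X → X → ℝ≥0∞) (μ : Measure X) (x : X) : ℝ≥0∞ :=
  ∫⁻ y, κ x y ∂μ

/-- The mutual energy `I(μ, ν) = ∫ κ d(μ ⊗ ν)` of positive measures. -/
noncomputable def mutualEnergy (κ : X → X → ℝ≥0∞) (μ ν : Measure X) : ℝ≥0∞ :=
  ∫⁻ p, κ p.1 p.2 ∂(μ.prod ν)

/-- The energy `I(μ) = I(μ, μ)`. -/
noncomputable def energy (κ : X → X → ℝ≥0∞) (μ : Measure X) : ℝ≥0∞ :=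
  mutualEnergy κ μ μ

/-- The cone `ℰ⁺` of positive Radon measures of finite energy. -/
def FinEnergy (κ : X → X → ℝ≥0∞) : Set (Measure X) :=
  {μ | μ ∈ RadonPos X ∧ energy κ μ < ∞}

/-- The cone `ℰ⁺(A)` of positive Radon measures of finite energy concentrated on `A`, that is,
such that the complement of `A` is negligible. -/
def FinEnergyOn (κ : X → X → ℝ≥0∞) (A : Set X) : Set (Measure X) :=
  {μ | μ ∈ FinEnergy κ ∧ μ Aᶜ = 0}

/-- The energy principle (strict positive definiteness). A signed Radon measure of finite energy is
a difference `μ - ν` with `μ, ν ∈ ℰ⁺`, and `I(μ - ν) = I(μ) + I(ν) - 2 I(μ, ν)`; the principle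
says that this is `≥ 0` (and not `-∞`), and that it vanishes only if `μ - ν = 0`. -/
def EnergyPrinciple (κ : X → X → ℝ≥0∞) : Prop :=
  ∀ μ ∈ FinEnergy κ, ∀ ν ∈ FinEnergy κ,
    2 * mutualEnergy κ μ ν ≤ energy κ μ + energy κ ν ∧
    (2 * mutualEnergy κ μ ν = energy κ μ + energy κ ν → μ = ν)

/-- The squared strong (energy-norm) distance `‖μ - ν‖² = I(μ) + I(ν) - 2 I(μ, ν)`
for `μ, ν ∈ ℰ⁺`. -/
noncomputable def distSq (κ : X → X → ℝ≥0∞) (μ ν : Measure X) : ℝ :=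
  (energy κ μ).toReal + (energy κ ν).toReal - 2 * (mutualEnergy κ μ ν).toReal

/-- Strong convergence `‖m i - μ‖ → 0` along a filter. -/
def StrongTendsto {ι : Type*} (κ : X → X → ℝ≥0∞) (m : ι → Measure X) (l : Filter ι)
    (μ : Measure X) : Prop :=
  Tendsto (fun i => distSq κ (m i) μ) l (𝓝 0)

/-- Vague convergence along a filter: convergence of the integrals of all continuous functions of
compact support. -/
def VagueTendsto {ι : Type*} (m : ι → Measure X) (l : Filter ι) (μ : Measure X) : Prop :=
  ∀ φ : X → ℝ, Continuous φ → HasCompactSupport φ →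
    Tendsto (fun i => ∫ x, φ x ∂(m i)) l (𝓝 (∫ x, φ x ∂μ))

/-- The consistency principle: `ℰ⁺` is complete in the strong topology, and the strong topology on
`ℰ⁺` is finer than the vague one. (The strong topology comes from a norm, so that sequences
suffice for both.) -/
structure ConsistencyPrinciple (κ : X → X → ℝ≥0∞) : Prop where
  complete : ∀ m : ℕ → Measure X, (∀ n, m n ∈ FinEnergy κ) →
    (∀ ε : ℝ, 0 < ε → ∃ N, ∀ i ≥ N, ∀ j ≥ N, distSq κ (m i) (m j) < ε) →
    ∃ μ ∈ FinEnergy κ, StrongTendsto κ m atTop μ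
  finer : ∀ m : ℕ → Measure X, (∀ n, m n ∈ FinEnergy κ) → ∀ μ ∈ FinEnergy κ,
    StrongTendsto κ m atTop μ → VagueTendsto m atTop μ

/-- A perfect kernel: the energy and consistency principles hold. -/
structure IsPerfect (κ : X → X → ℝ≥0∞) : Prop where
  energy_principle : EnergyPrinciple κ
  consistency : ConsistencyPrinciple κ

/-- The domination principle. -/
def DominationPrinciple (κ : X → X → ℝ≥0∞) : Prop :=
  ∀ μ ∈ FinEnergy κ, ∀ ν ∈ RadonPos X,
    (∀ᵐ x ∂μ, potential κ μ x ≤ potential κ ν x) → ∀ x, potential κ μ x ≤ potential κ ν x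

/-- The Ugaheri maximum principle, with some constant `M ∈ [1, ∞)`. -/
def UgaheriPrinciple (κ : X → X → ℝ≥0∞) : Prop :=
  ∃ M : ℝ, 1 ≤ M ∧ ∀ μ ∈ FinEnergy κ, ∀ c : ℝ, 0 < c →
    (∀ᵐ x ∂μ, potential κ μ x ≤ ENNReal.ofReal c) →
    ∀ x, potential κ μ x ≤ ENNReal.ofReal (M * c)

/-- The capacity `c(K) = 1 / inf I(μ)` of a compact set `K`, the infimum being over the positive
Radon measures `μ` of total mass `1` concentrated on `K` (`1 / ∞ = 0`, `1 / 0 = ∞`). -/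
noncomputable def compactCapacity (κ : X → X → ℝ≥0∞) (K : Set X) : ℝ≥0∞ :=
  (⨅ μ ∈ {μ : Measure X | μ ∈ RadonPos X ∧ μ Kᶜ = 0 ∧ μ univ = 1}, energy κ μ)⁻¹

/-- The inner capacity `c_*(A)`: the supremum of the capacities of the compact subsets of `A`. -/
noncomputable def innerCapacity (κ : X → X → ℝ≥0∞) (A : Set X) : ℝ≥0∞ :=
  ⨆ K ∈ {K : Set X | IsCompact K ∧ K ⊆ A}, compactCapacity κ K

/-- `P` holds nearly everywhere (n.e.) on `A`: the set of points of `A` where it fails has inner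
capacity zero. -/
def NearlyEverywhereOn (κ : X → X → ℝ≥0∞) (A : Set X) (P : X → Prop) : Prop :=
  innerCapacity κ {x | x ∈ A ∧ ¬ P x} = 0

/-- The cone `ℰ⁺(A)` is closed in the strong topology. -/
def StronglyClosed (κ : X → X → ℝ≥0∞) (A : Set X) : Prop :=
  ∀ m : ℕ → Measure X, (∀ n, m n ∈ FinEnergyOn κ A) → ∀ μ ∈ FinEnergy κ,
    StrongTendsto κ m atTop μ → μ ∈ FinEnergyOn κ A

/-- `ν` belongs to `ℰ⁺(A)` and `U^ν = U^ω` n.e. on `A`. -/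
def IsSwept (κ : X → X → ℝ≥0∞) (A : Set X) (ω ν : Measure X) : Prop :=
  ν ∈ FinEnergyOn κ A ∧ NearlyEverywhereOn κ A fun x => potential κ ν x = potential κ ω x

/-- The class `ℰ_f⁺(A)`, where `f = -U^ω`: the `μ ∈ ℰ⁺(A)` for which `f` is `μ`-integrable. -/
def FinEnergyField (κ : X → X → ℝ≥0∞) (A : Set X) (ω : Measure X) : Set (Measure X) :=
  {μ | μ ∈ FinEnergyOn κ A ∧ ∫⁻ x, potential κ ω x ∂μ < ∞}

/-- The Gauss functional `I_f(μ) = ‖μ‖² + 2 ∫ f dμ`, where `f = -U^ω`, for `μ ∈ ℰ_f⁺(A)`. -/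
noncomputable def gauss (κ : X → X → ℝ≥0∞) (ω μ : Measure X) : ℝ :=
  (energy κ μ).toReal - 2 * (∫⁻ x, potential κ ω x ∂μ).toReal

/-- The infimum of the Gauss functional over `ℰ_f⁺(A)`, in `[-∞, ∞]`. -/
noncomputable def gaussInf (κ : X → X → ℝ≥0∞) (A : Set X) (ω : Measure X) : EReal :=
  ⨅ μ ∈ FinEnergyField κ A ω, (gauss κ ω μ : EReal)

/-- The class `Γ_{A,ω}` of positive Radon measures `ν` with `U^ν ≥ U^ω` n.e. on `A`. -/
def Dominating (κ : X → X → ℝ≥0∞) (A : Set X) (ω : Measure X) : Set (Measure X) :=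
  {ν | ν ∈ RadonPos X ∧ NearlyEverywhereOn κ A fun x => potential κ ω x ≤ potential κ ν x}

/-- The compact subsets of `A`, ordered by inclusion (an upward directed set). -/
abbrev CompactSub (A : Set X) : Type _ := {K : Set X // IsCompact K ∧ K ⊆ A}

end Balayage

open Balayage

/-!
# Inner balayage of Radon measures with respect to a perfect kernel
-/

set_option linter.unusedSectionVars false

namespace Balayage

section RadonMeasures

variable {X : Type*} [TopologicalSpace X] [MeasurableSpace X]

/-! Balayage is a variational problem: minimize ‖μ‖² - 2 ∫ U^ω dμ over the convex cone ℰ⁺(A). The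
parallelogram identity and strong completeness give a minimizer (`exists_isMinOn_quadFun`). Its
first variation says that its potential is at least U^ω a.e. for every measure of the cone, with
equality a.e. for the minimizer itself (`ae_potential_of_isMinOn`). The domination principle then
gives U^μ ≤ U^ω everywhere, hence equality n.e. on A.

For ω of finite energy this is the projection of ω onto the cone. Otherwise the argument is run on
compact K ⊆ A, where energy controls the squared mass (`exists_sq_mass_le`) and the continuous U^ω
passes to vague limits. Ugaheri's principle bounds the energies of the ω^K uniformly
(`UgaheriPrinciple.exists_energy_le`). These energies increase with K, so the ω^K are strongly
Cauchy, and their limit is swept onto A (`exists_isSwept_of_forall_compact`).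

Once a swept measure ν exists, the characterizations are formal: n.e. equality holds τ-a.e. for all
τ in ℰ⁺(A), so the Gauss functional is ‖μ - ν‖² - ‖ν‖², and domination makes U^ν the least potential
in Γ. -/

theorem add_mem_radonPos {μ ν : Measure X} (hμ : μ ∈ RadonPos X) (hν : ν ∈ RadonPos X) :
    μ + ν ∈ RadonPos X :=
  ⟨fun K hK => by
    simpa using ⟨hμ.lt_top_of_isCompact hK, hν.lt_top_of_isCompact hK⟩⟩

theorem smul_mem_radonPos {μ : Measure X} (hμ : μ ∈ RadonPos X) {c : ℝ≥0∞} (hc : c ≠ ∞) :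
    c • μ ∈ RadonPos X :=
  have : IsFiniteMeasureOnCompacts μ := hμ
  IsFiniteMeasureOnCompacts.smul μ hc

theorem mem_radonPos_of_le {μ ν : Measure X} (hν : ν ∈ RadonPos X) (h : μ ≤ ν) :
    μ ∈ RadonPos X :=
  ⟨fun _ hK => (h _).trans_lt (hν.lt_top_of_isCompact hK)⟩

end RadonMeasures

variable {X : Type*} [TopologicalSpace X] [T2Space X] [LocallyCompactSpace X]
    [SecondCountableTopology X] [MeasurableSpace X] [BorelSpace X] {κ : X → X → ℝ≥0∞}

theorem sigmaFinite_of_mem_radonPos {μ : Measure X} (hμ : μ ∈ RadonPos X) : SigmaFinite μ :=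
  have : IsFiniteMeasureOnCompacts μ := hμ
  inferInstance

theorem regular_of_mem_radonPos {μ : Measure X} (hμ : μ ∈ RadonPos X) : μ.Regular :=
  have : IsFiniteMeasureOnCompacts μ := hμ
  inferInstance

/-! ### Potentials, mutual energy and the cones of finite energy -/

theorem IsKernel.measurable (hκ : IsKernel κ) : Measurable fun p : X × X => κ p.1 p.2 :=
  hκ.lsc.measurable

theorem measurable_potential (hκ : IsKernel κ) {μ : Measure X} (hμ : μ ∈ RadonPos X) :
    Measurable (potential κ μ) :=
  have := sigmaFinite_of_mem_radonPos hμ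
  hκ.measurable.lintegral_prod_right'

theorem mutualEnergy_eq_lintegral (hκ : IsKernel κ) (μ : Measure X) {ν : Measure X}
    (hν : ν ∈ RadonPos X) : mutualEnergy κ μ ν = ∫⁻ x, potential κ ν x ∂μ :=
  have := sigmaFinite_of_mem_radonPos hν
  lintegral_prod _ hκ.measurable.aemeasurable

theorem mutualEnergy_comm (hκ : IsKernel κ) {μ ν : Measure X} (hμ : μ ∈ RadonPos X)
    (hν : ν ∈ RadonPos X) : mutualEnergy κ μ ν = mutualEnergy κ ν μ := by
  have := sigmaFinite_of_mem_radonPos hμ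
  have := sigmaFinite_of_mem_radonPos hν
  rw [mutualEnergy_eq_lintegral hκ ν hμ, mutualEnergy, lintegral_prod_symm _
    hκ.measurable.aemeasurable]
  simp only [potential, hκ.symm]

theorem lintegral_potential_comm (hκ : IsKernel κ) {μ ν : Measure X} (hμ : μ ∈ RadonPos X)
    (hν : ν ∈ RadonPos X) : ∫⁻ x, potential κ ν x ∂μ = ∫⁻ x, potential κ μ x ∂ν := by
  rw [← mutualEnergy_eq_lintegral hκ μ hν, ← mutualEnergy_eq_lintegral hκ ν hμ,
    mutualEnergy_comm hκ hμ hν]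

theorem mutualEnergy_add_left (hκ : IsKernel κ) (μ μ' : Measure X) {ν : Measure X}
    (hν : ν ∈ RadonPos X) :
    mutualEnergy κ (μ + μ') ν = mutualEnergy κ μ ν + mutualEnergy κ μ' ν := by
  simp only [mutualEnergy_eq_lintegral hκ _ hν, lintegral_add_measure]

theorem mutualEnergy_smul_left (hκ : IsKernel κ) (c : ℝ≥0∞) (μ : Measure X) {ν : Measure X}
    (hν : ν ∈ RadonPos X) :
    mutualEnergy κ (c • μ) ν = c * mutualEnergy κ μ ν := by
  simp only [mutualEnergy_eq_lintegral hκ _ hν, lintegral_smul_measure, smul_eq_mul]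

theorem mutualEnergy_add_right (hκ : IsKernel κ) {μ ν ν' : Measure X} (hμ : μ ∈ RadonPos X)
    (hν : ν ∈ RadonPos X) (hν' : ν' ∈ RadonPos X) :
    mutualEnergy κ μ (ν + ν') = mutualEnergy κ μ ν + mutualEnergy κ μ ν' := by
  rw [mutualEnergy_comm hκ hμ (add_mem_radonPos hν hν'), mutualEnergy_add_left hκ _ _ hμ,
    mutualEnergy_comm hκ hν hμ, mutualEnergy_comm hκ hν' hμ]

theorem mutualEnergy_smul_right (hκ : IsKernel κ) {c : ℝ≥0∞} (hc : c ≠ ∞) {μ ν : Measure X}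
    (hμ : μ ∈ RadonPos X) (hν : ν ∈ RadonPos X) :
    mutualEnergy κ μ (c • ν) = c * mutualEnergy κ μ ν := by
  rw [mutualEnergy_comm hκ hμ (smul_mem_radonPos hν hc), mutualEnergy_smul_left hκ _ _ hμ,
    mutualEnergy_comm hκ hν hμ]

theorem energy_mono {μ ν : Measure X} (hν : ν ∈ RadonPos X) (h : μ ≤ ν) :
    energy κ μ ≤ energy κ ν :=
  have := sigmaFinite_of_mem_radonPos hν
  lintegral_mono' (Measure.prod_mono h h) le_rfl

theorem mem_finEnergy_of_le {μ ν : Measure X} (hν : ν ∈ FinEnergy κ) (h : μ ≤ ν) :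
    μ ∈ FinEnergy κ :=
  ⟨mem_radonPos_of_le hν.1 h, (energy_mono hν.1 h).trans_lt hν.2⟩

theorem mem_finEnergyOn_of_le {A : Set X} {μ ν : Measure X} (hν : ν ∈ FinEnergyOn κ A)
    (h : μ ≤ ν) : μ ∈ FinEnergyOn κ A :=
  ⟨mem_finEnergy_of_le hν.1 h, le_antisymm ((h _).trans hν.2.le) bot_le⟩

theorem restrict_mem_finEnergyOn {A : Set X} {μ : Measure X} (hμ : μ ∈ FinEnergyOn κ A)
    (B : Set X) : μ.restrict B ∈ FinEnergyOn κ A :=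
  mem_finEnergyOn_of_le hμ Measure.restrict_le_self

theorem restrict_mem_finEnergyOn_self {μ : Measure X} (hμ : μ ∈ FinEnergy κ) {B : Set X}
    (hB : MeasurableSet B) : μ.restrict B ∈ FinEnergyOn κ B :=
  ⟨mem_finEnergy_of_le hμ Measure.restrict_le_self, by simp [Measure.restrict_apply hB.compl]⟩

theorem finEnergyOn_mono {A B : Set X} (h : A ⊆ B) {μ : Measure X} (hμ : μ ∈ FinEnergyOn κ A) :
    μ ∈ FinEnergyOn κ B :=
  ⟨hμ.1, measure_mono_null (compl_subset_compl.2 h) hμ.2⟩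

theorem mutualEnergy_lt_top (he : EnergyPrinciple κ) {μ ν : Measure X} (hμ : μ ∈ FinEnergy κ)
    (hν : ν ∈ FinEnergy κ) : mutualEnergy κ μ ν < ∞ := by
  have h := ((he μ hμ ν hν).1).trans_lt (ENNReal.add_lt_top.2 ⟨hμ.2, hν.2⟩)
  exact lt_of_le_of_lt (le_mul_of_one_le_left bot_le (by norm_num)) h

theorem zero_mem_finEnergyOn (A : Set X) : (0 : Measure X) ∈ FinEnergyOn κ A :=
  ⟨⟨⟨fun _ _ => by simp⟩, by simp [energy, mutualEnergy]⟩, by simp⟩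

theorem add_mem_finEnergyOn (hκ : IsKernel κ) (he : EnergyPrinciple κ) {A : Set X}
    {μ ν : Measure X} (hμ : μ ∈ FinEnergyOn κ A) (hν : ν ∈ FinEnergyOn κ A) :
    μ + ν ∈ FinEnergyOn κ A := by
  refine ⟨⟨add_mem_radonPos hμ.1.1 hν.1.1, ?_⟩, by simp [hμ.2, hν.2]⟩
  rw [energy, mutualEnergy_add_left hκ _ _ (add_mem_radonPos hμ.1.1 hν.1.1),
    mutualEnergy_add_right hκ hμ.1.1 hμ.1.1 hν.1.1, mutualEnergy_add_right hκ hν.1.1 hμ.1.1 hν.1.1]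
  simp [mutualEnergy_lt_top he, hμ.1, hν.1]

theorem smul_mem_finEnergyOn (hκ : IsKernel κ) {c : ℝ≥0∞} (hc : c ≠ ∞) {A : Set X}
    {μ : Measure X} (hμ : μ ∈ FinEnergyOn κ A) : c • μ ∈ FinEnergyOn κ A := by
  refine ⟨⟨smul_mem_radonPos hμ.1.1 hc, ?_⟩, by simp [hμ.2]⟩
  rw [energy, mutualEnergy_smul_left hκ _ _ (smul_mem_radonPos hμ.1.1 hc),
    mutualEnergy_smul_right hκ hc hμ.1.1 hμ.1.1]
  exact ENNReal.mul_lt_top hc.lt_top (ENNReal.mul_lt_top hc.lt_top hμ.1.2)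

theorem mem_finEnergyOn_univ {μ : Measure X} : μ ∈ FinEnergyOn κ univ ↔ μ ∈ FinEnergy κ :=
  ⟨fun h => h.1, fun h => ⟨h, by simp⟩⟩

theorem add_mem_finEnergy (hκ : IsKernel κ) (he : EnergyPrinciple κ) {μ ν : Measure X}
    (hμ : μ ∈ FinEnergy κ) (hν : ν ∈ FinEnergy κ) : μ + ν ∈ FinEnergy κ :=
  (add_mem_finEnergyOn hκ he (mem_finEnergyOn_univ.2 hμ) (mem_finEnergyOn_univ.2 hν)).1

theorem smul_mem_finEnergy (hκ : IsKernel κ) {c : ℝ≥0∞} (hc : c ≠ ∞) {μ : Measure X}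
    (hμ : μ ∈ FinEnergy κ) : c • μ ∈ FinEnergy κ :=
  (smul_mem_finEnergyOn hκ hc (mem_finEnergyOn_univ.2 hμ)).1

/-! ### The pre-Hilbert structure -/

/-- The mutual energy as a real number. -/
noncomputable def pairing (κ : X → X → ℝ≥0∞) (μ ν : Measure X) : ℝ :=
  (mutualEnergy κ μ ν).toReal

theorem distSq_eq (μ ν : Measure X) :
    distSq κ μ ν = pairing κ μ μ + pairing κ ν ν - 2 * pairing κ μ ν := rfl

theorem pairing_nonneg (μ ν : Measure X) : 0 ≤ pairing κ μ ν := ENNReal.toReal_nonneg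

theorem pairing_comm (hκ : IsKernel κ) {μ ν : Measure X} (hμ : μ ∈ FinEnergy κ)
    (hν : ν ∈ FinEnergy κ) : pairing κ μ ν = pairing κ ν μ := by
  rw [pairing, mutualEnergy_comm hκ hμ.1 hν.1, pairing]

theorem pairing_add_left (hκ : IsKernel κ) (he : EnergyPrinciple κ) {μ μ' ν : Measure X}
    (hμ : μ ∈ FinEnergy κ) (hμ' : μ' ∈ FinEnergy κ) (hν : ν ∈ FinEnergy κ) :
    pairing κ (μ + μ') ν = pairing κ μ ν + pairing κ μ' ν := by
  rw [pairing, mutualEnergy_add_left hκ _ _ hν.1, ENNReal.toReal_add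
    (mutualEnergy_lt_top he hμ hν).ne (mutualEnergy_lt_top he hμ' hν).ne, pairing, pairing]

theorem pairing_add_right (hκ : IsKernel κ) (he : EnergyPrinciple κ) {μ ν ν' : Measure X}
    (hμ : μ ∈ FinEnergy κ) (hν : ν ∈ FinEnergy κ) (hν' : ν' ∈ FinEnergy κ) :
    pairing κ μ (ν + ν') = pairing κ μ ν + pairing κ μ ν' := by
  rw [pairing_comm hκ hμ (add_mem_finEnergy hκ he hν hν'), pairing_add_left hκ he hν hν' hμ,
    pairing_comm hκ hν hμ, pairing_comm hκ hν' hμ]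

theorem pairing_smul_left (hκ : IsKernel κ) {t : ℝ} (ht : 0 ≤ t) (μ : Measure X) {ν : Measure X}
    (hν : ν ∈ FinEnergy κ) :
    pairing κ (ENNReal.ofReal t • μ) ν = t * pairing κ μ ν := by
  rw [pairing, mutualEnergy_smul_left hκ _ _ hν.1, ENNReal.toReal_mul, ENNReal.toReal_ofReal ht,
    pairing]

theorem pairing_smul_right (hκ : IsKernel κ) {t : ℝ} (ht : 0 ≤ t) {μ ν : Measure X}
    (hμ : μ ∈ FinEnergy κ) (hν : ν ∈ FinEnergy κ) :
    pairing κ μ (ENNReal.ofReal t • ν) = t * pairing κ μ ν := by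
  rw [pairing, mutualEnergy_smul_right hκ ENNReal.ofReal_ne_top hμ.1 hν.1, ENNReal.toReal_mul,
    ENNReal.toReal_ofReal ht, pairing]

theorem distSq_nonneg (he : EnergyPrinciple κ) {μ ν : Measure X} (hμ : μ ∈ FinEnergy κ)
    (hν : ν ∈ FinEnergy κ) : 0 ≤ distSq κ μ ν := by
  have h := ENNReal.toReal_mono (ENNReal.add_lt_top.2 ⟨hμ.2, hν.2⟩).ne (he μ hμ ν hν).1
  rw [ENNReal.toReal_add hμ.2.ne hν.2.ne, ENNReal.toReal_mul] at h
  simp only [ENNReal.toReal_ofNat] at h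
  rw [distSq]
  linarith

theorem eq_of_distSq_nonpos (he : EnergyPrinciple κ) {μ ν : Measure X} (hμ : μ ∈ FinEnergy κ)
    (hν : ν ∈ FinEnergy κ) (h : distSq κ μ ν ≤ 0) : μ = ν := by
  refine (he μ hμ ν hν).2 (le_antisymm (he μ hμ ν hν).1 ?_)
  rw [← ENNReal.toReal_le_toReal (ENNReal.add_lt_top.2 ⟨hμ.2, hν.2⟩).ne
    (ENNReal.mul_lt_top (by simp) (mutualEnergy_lt_top he hμ hν)).ne,
    ENNReal.toReal_add hμ.2.ne hν.2.ne, ENNReal.toReal_mul]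
  simp only [ENNReal.toReal_ofNat]
  rw [distSq] at h
  linarith

/-- Cauchy–Schwarz for the signed measure α - β against μ, by the discriminant of t ↦ ‖α - β + tμ‖².
Only positive measures are available, so for t ≥ 0 this is the distance from α + tμ to β, and for t
≤ 0 the roles of α and β are swapped. -/
theorem sq_pairing_sub_le (hκ : IsKernel κ) (he : EnergyPrinciple κ) {α β μ : Measure X}
    (hα : α ∈ FinEnergy κ) (hβ : β ∈ FinEnergy κ) (hμ : μ ∈ FinEnergy κ) :
    (pairing κ α μ - pairing κ β μ) ^ 2 ≤ distSq κ α β * pairing κ μ μ := by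
  have key : ∀ {α β : Measure X}, α ∈ FinEnergy κ → β ∈ FinEnergy κ → ∀ t : ℝ, 0 ≤ t →
      0 ≤ pairing κ μ μ * (t * t) + (2 * (pairing κ α μ - pairing κ β μ)) * t + distSq κ α β := by
    intro α β hα hβ t ht
    have hs := smul_mem_finEnergy hκ (ENNReal.ofReal_ne_top (r := t)) hμ
    have hs' := add_mem_finEnergy hκ he hα hs
    have := distSq_nonneg he hs' hβ
    rw [distSq_eq, pairing_add_left hκ he hα hs hs', pairing_add_right hκ he hα hα hs,
      pairing_add_right hκ he hs hα hs, pairing_add_left hκ he hα hs hβ,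
      pairing_smul_left hκ ht _ hs, pairing_smul_left hκ ht _ hα, pairing_smul_left hκ ht _ hβ,
      pairing_smul_right hκ ht hα hμ, pairing_smul_right hκ ht hμ hμ,
      pairing_comm hκ hμ hα, pairing_comm hκ hμ hβ] at this
    rw [distSq_eq]
    linarith
  have h : ∀ t : ℝ,
      0 ≤ pairing κ μ μ * (t * t) + (2 * (pairing κ α μ - pairing κ β μ)) * t + distSq κ α β := by
    intro t
    rcases le_total 0 t with ht | ht
    · exact key hα hβ t ht
    · have := key hβ hα (-t) (by linarith)
      have hd : distSq κ β α = distSq κ α β := by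
        rw [distSq_eq, distSq_eq, pairing_comm hκ hβ hα]; ring
      rw [hd] at this
      linarith
  have := discrim_le_zero h
  rw [discrim] at this
  linarith

theorem StrongTendsto.pairing {ι : Type*} {l : Filter ι} (hκ : IsKernel κ)
    (he : EnergyPrinciple κ) {m : ι → Measure X} (hm : ∀ i, m i ∈ FinEnergy κ) {μ : Measure X}
    (hμ : μ ∈ FinEnergy κ) (h : StrongTendsto κ m l μ) {τ : Measure X} (hτ : τ ∈ FinEnergy κ) :
    Tendsto (fun i => Balayage.pairing κ (m i) τ) l (𝓝 (Balayage.pairing κ μ τ)) := by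
  rw [← tendsto_sub_nhds_zero_iff]
  have h2 : Tendsto (fun i => (Balayage.pairing κ (m i) τ - Balayage.pairing κ μ τ) ^ 2) l (𝓝 0) :=
    squeeze_zero (fun i => sq_nonneg _) (fun i => sq_pairing_sub_le hκ he (hm i) hμ hτ)
      (by simpa using Tendsto.mul_const (Balayage.pairing κ τ τ) h)
  have h3 := h2.sqrt
  simp only [Real.sqrt_sq_eq_abs, Real.sqrt_zero] at h3
  exact (tendsto_zero_iff_abs_tendsto_zero _).2 h3

theorem StrongTendsto.pairing_self {ι : Type*} {l : Filter ι} (hκ : IsKernel κ)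
    (he : EnergyPrinciple κ) {m : ι → Measure X} (hm : ∀ i, m i ∈ FinEnergy κ) {μ : Measure X}
    (hμ : μ ∈ FinEnergy κ) (h : StrongTendsto κ m l μ) :
    Tendsto (fun i => Balayage.pairing κ (m i) (m i)) l (𝓝 (Balayage.pairing κ μ μ)) := by
  have h1 := (h.pairing hκ he hm hμ hμ).const_mul 2
  have h2 := (Tendsto.add h h1).sub_const (Balayage.pairing κ μ μ)
  simp only [distSq_eq] at h2
  convert h2 using 2 <;> ring

/-! ### Nearly everywhere -/

/-- A unit measure of finite energy on a compact part of the exceptional set would give that set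
mass zero. No measurability of `P` is needed. -/
theorem nearlyEverywhereOn_of_ae {A : Set X} {P : X → Prop}
    (h : ∀ K, IsCompact K → K ⊆ A → ∀ μ ∈ FinEnergyOn κ K, ∀ᵐ x ∂μ, P x) :
    NearlyEverywhereOn κ A P := by
  simp only [NearlyEverywhereOn, innerCapacity, ← bot_eq_zero, iSup_eq_bot]
  rintro K ⟨hK, hKA⟩
  rw [compactCapacity, bot_eq_zero, ENNReal.inv_eq_zero]
  simp only [iInf_eq_top]
  rintro μ ⟨hμ, hμK, hμ1⟩
  by_contra hne
  have hP := h K hK (fun x hx => (hKA hx).1) μ ⟨⟨hμ, lt_top_iff_ne_top.2 hne⟩, hμK⟩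
  have h0 : μ K = 0 := measure_mono_null (fun x hx => (hKA hx).2) hP
  have : μ univ = 0 := by
    rw [← union_compl_self K]
    exact measure_union_null h0 hμK
  simp [this] at hμ1

theorem exists_isCompact_measure_ne_zero {μ : Measure X} (hμ : μ ∈ RadonPos X) {B : Set X}
    (hB : MeasurableSet B) (h : μ B ≠ 0) : ∃ K ⊆ B, IsCompact K ∧ μ K ≠ 0 := by
  have := regular_of_mem_radonPos hμ
  have := sigmaFinite_of_mem_radonPos hμ
  obtain ⟨K, hKB, hK, h0⟩ := hB.exists_lt_isCompact (μ := μ) (pos_iff_ne_zero.2 h)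
  exact ⟨K, hKB, hK, h0.ne'⟩

/-- Otherwise μ charges a compact subset K of the exceptional set, and the normalized restriction of
μ to K shows that K has positive capacity. -/
theorem ae_of_nearlyEverywhereOn (hκ : IsKernel κ) {A : Set X} {P : X → Prop}
    (hP : MeasurableSet {x | P x}) (h : NearlyEverywhereOn κ A P) {μ : Measure X}
    (hμ : μ ∈ FinEnergyOn κ A) : ∀ᵐ x ∂μ, P x := by
  by_contra hne
  -- `A` need not be measurable; the complement of a measurable hull of `Aᶜ` is a measurable subset
  -- of `A` carrying μ.
  have hB : MeasurableSet ((toMeasurable μ Aᶜ)ᶜ ∩ {x | P x}ᶜ) :=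
    (measurableSet_toMeasurable _ _).compl.inter hP.compl
  have hB0 : μ ((toMeasurable μ Aᶜ)ᶜ ∩ {x | P x}ᶜ) ≠ 0 := by
    intro h0
    refine hne (measure_mono_null (t := toMeasurable μ Aᶜ ∪
      ((toMeasurable μ Aᶜ)ᶜ ∩ {x | P x}ᶜ)) ?_ (measure_union_null ?_ h0))
    · intro x hx
      by_cases hxA : x ∈ toMeasurable μ Aᶜ
      · exact Or.inl hxA
      · exact Or.inr ⟨hxA, hx⟩
    · rw [measure_toMeasurable, hμ.2]
  obtain ⟨K, hKB, hK, hK0⟩ := exists_isCompact_measure_ne_zero hμ.1.1 hB hB0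
  have hKsub : K ⊆ {x | x ∈ A ∧ ¬ P x} := fun x hx =>
    ⟨by_contra fun hxA => (hKB hx).1 (subset_toMeasurable μ Aᶜ hxA), (hKB hx).2⟩
  simp only [NearlyEverywhereOn, innerCapacity, ← bot_eq_zero, iSup_eq_bot] at h
  have hcap := h K ⟨hK, hKsub⟩
  rw [compactCapacity, bot_eq_zero, ENNReal.inv_eq_zero] at hcap
  simp only [iInf_eq_top] at hcap
  have hc : (μ K)⁻¹ ≠ ∞ := ENNReal.inv_ne_top.2 hK0
  have hν := smul_mem_finEnergyOn hκ hc (restrict_mem_finEnergyOn_self hμ.1 hK.measurableSet)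
  refine hν.1.2.ne (hcap _ ⟨hν.1.1, hν.2, ?_⟩)
  simp [ENNReal.inv_mul_cancel hK0 (hμ.1.1.lt_top_of_isCompact hK).ne]

/-! ### Vague convergence -/

/-- Consistency speaks of sequences; since strong convergence is measured by one real number, a
failure along a filter yields a sequence that fails. -/
theorem StrongTendsto.vagueTendsto (hc : ConsistencyPrinciple κ) {ι : Type*} {l : Filter ι}
    {m : ι → Measure X} (hm : ∀ i, m i ∈ FinEnergy κ) {μ : Measure X} (hμ : μ ∈ FinEnergy κ)
    (he : EnergyPrinciple κ) (h : StrongTendsto κ m l μ) : VagueTendsto m l μ := by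
  intro φ hφ hφc
  by_contra hne
  rw [Metric.tendsto_nhds] at hne
  push Not at hne
  obtain ⟨ε, hε, hfr⟩ := hne
  have hex : ∀ n : ℕ, ∃ i, distSq κ (m i) μ < 1 / (n + 1) ∧
      ε ≤ dist (∫ x, φ x ∂(m i)) (∫ x, φ x ∂μ) := by
    intro n
    have hev := (tendsto_order.1 h).2 (1 / ((n : ℝ) + 1)) (by positivity)
    obtain ⟨i, hi, hi'⟩ := (hfr.and_eventually hev).exists
    exact ⟨i, hi', by simpa using hi⟩
  choose i hi hi' using hex
  have hs : StrongTendsto κ (fun n => m (i n)) atTop μ :=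
    squeeze_zero (fun n => distSq_nonneg he (hm _) hμ) (fun n => (hi n).le)
      tendsto_one_div_add_atTop_nhds_zero_nat
  have hv := hc.finer _ (fun n => hm (i n)) μ hμ hs φ hφ hφc
  obtain ⟨n, hn⟩ := ((Metric.tendsto_nhds.1 hv) ε hε).exists
  exact absurd hn (not_lt.2 (hi' n))

theorem lintegral_ofReal_eq {μ : Measure X} (hμ : μ ∈ RadonPos X) {φ : X → ℝ}
    (hφ : Continuous φ) (hc : HasCompactSupport φ) (h0 : ∀ x, 0 ≤ φ x) :
    ∫⁻ x, ENNReal.ofReal (φ x) ∂μ = ENNReal.ofReal (∫ x, φ x ∂μ) := by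
  have : IsFiniteMeasureOnCompacts μ := hμ
  rw [ofReal_integral_eq_lintegral_ofReal (hφ.integrable_of_hasCompactSupport hc)
    (Eventually.of_forall h0)]

theorem VagueTendsto.measure_le_liminf {m : ℕ → Measure X} (hm : ∀ n, m n ∈ RadonPos X)
    {μ : Measure X} (hμ : μ ∈ RadonPos X) (h : VagueTendsto m atTop μ) {G : Set X}
    (hG : IsOpen G) : μ G ≤ liminf (fun n => m n G) atTop := by
  have := regular_of_mem_radonPos hμ
  refine le_of_forall_lt fun r hr => ?_
  obtain ⟨K, hKG, hK, hrK⟩ := hG.exists_lt_isCompact hr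
  obtain ⟨f, hf1, hf0, hfc, hf⟩ := exists_continuous_one_zero_of_isCompact hK hG.isClosed_compl
    (disjoint_compl_right_iff_subset.2 hKG)
  refine hrK.trans_le ?_
  have h1 : μ K ≤ ∫⁻ x, ENNReal.ofReal (f x) ∂μ := by
    rw [← setLIntegral_one]
    refine (setLIntegral_mono' hK.measurableSet fun x hx => ?_).trans (setLIntegral_le_lintegral K _)
    simp [hf1 hx]
  have h2 : ∀ n, ∫⁻ x, ENNReal.ofReal (f x) ∂(m n) ≤ m n G := by
    intro n
    rw [← lintegral_indicator_one hG.measurableSet]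
    refine lintegral_mono fun x => ?_
    by_cases hx : x ∈ G
    · simpa [hx] using (hf x).2
    · simp [hx, hf0 (mem_compl hx)]
  have h3 : Tendsto (fun n => ∫⁻ x, ENNReal.ofReal (f x) ∂(m n)) atTop
      (𝓝 (∫⁻ x, ENNReal.ofReal (f x) ∂μ)) := by
    simp only [fun n => lintegral_ofReal_eq (hm n) f.continuous hfc fun x => (hf x).1,
      lintegral_ofReal_eq hμ f.continuous hfc fun x => (hf x).1]
    exact (ENNReal.continuous_ofReal.tendsto _).comp (h f f.continuous hfc)
  calc μ K ≤ _ := h1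
    _ = liminf (fun n => ∫⁻ x, ENNReal.ofReal (f x) ∂(m n)) atTop := h3.liminf_eq.symm
    _ ≤ _ := liminf_le_liminf (Eventually.of_forall h2)

theorem VagueTendsto.lintegral_le_liminf {m : ℕ → Measure X} (hm : ∀ n, m n ∈ RadonPos X)
    {μ : Measure X} (hμ : μ ∈ RadonPos X) (h : VagueTendsto m atTop μ) {f : X → ℝ≥0∞}
    (hf : LowerSemicontinuous f) : ∫⁻ x, f x ∂μ ≤ liminf (fun n => ∫⁻ x, f x ∂(m n)) atTop := by
  have hfm : Measurable f := hf.measurable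
  have htop : ∀ (k : ℕ) (x : X), min (f x) k ≠ ∞ := fun k x =>
    ((min_le_right _ _).trans_lt (ENNReal.natCast_lt_top k)).ne
  -- The layer-cake formula reduces the claim to open superlevel sets; truncating at `k` keeps
  -- values finite, so `toReal` loses nothing.
  have cake : ∀ (k : ℕ) (ν : Measure X), ∫⁻ x, min (f x) k ∂ν =
      ∫⁻ t in Ioi (0 : ℝ), ν {x | t < (min (f x) k).toReal} := by
    intro k ν
    rw [← lintegral_eq_lintegral_meas_lt ν (Eventually.of_forall fun x => ENNReal.toReal_nonneg)
      (hfm.min measurable_const).ennreal_toReal.aemeasurable]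
    exact lintegral_congr fun x => (ENNReal.ofReal_toReal (htop k x)).symm
  have hopen : ∀ (k : ℕ) (t : ℝ), t ∈ Ioi (0 : ℝ) → IsOpen {x | t < (min (f x) k).toReal} := by
    intro k t ht
    have : {x | t < (min (f x) k).toReal} = f ⁻¹' Ioi (ENNReal.ofReal t) ∩
        {_x | ENNReal.ofReal t < k} := by
      ext x
      simp [← ENNReal.ofReal_lt_iff_lt_toReal (le_of_lt ht) (htop k x)]
    rw [this]
    exact (hf.isOpen_preimage _).inter isOpen_const
  have hk : ∀ k : ℕ, ∫⁻ x, min (f x) k ∂μ ≤ liminf (fun n => ∫⁻ x, f x ∂(m n)) atTop := by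
    intro k
    calc ∫⁻ x, min (f x) k ∂μ
        ≤ ∫⁻ t in Ioi (0 : ℝ), liminf (fun n => m n {x | t < (min (f x) k).toReal}) atTop := by
          rw [cake]
          exact setLIntegral_mono' measurableSet_Ioi fun t ht =>
            h.measure_le_liminf hm hμ (hopen k t ht)
      _ ≤ liminf (fun n => ∫⁻ t in Ioi (0 : ℝ), m n {x | t < (min (f x) k).toReal}) atTop :=
          lintegral_liminf_le fun n => Antitone.measurable fun s t hst =>
            measure_mono fun x hx => lt_of_le_of_lt hst hx
      _ ≤ _ := by
          refine liminf_le_liminf (Eventually.of_forall fun n => ?_)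
          simp only [← cake]
          exact lintegral_mono fun x => min_le_left _ _
  have hsup : ∀ x, f x = ⨆ k : ℕ, min (f x) (k : ℝ≥0∞) := by
    intro x
    rw [← inf_iSup_eq, ENNReal.iSup_natCast, inf_top_eq]
  calc ∫⁻ x, f x ∂μ = ∫⁻ x, ⨆ k : ℕ, min (f x) (k : ℝ≥0∞) ∂μ := lintegral_congr hsup
    _ = ⨆ k : ℕ, ∫⁻ x, min (f x) (k : ℝ≥0∞) ∂μ :=
        lintegral_iSup (fun k => hfm.min measurable_const) fun i j hij x =>
          min_le_min_left _ (by exact_mod_cast hij)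
    _ ≤ _ := iSup_le hk

theorem VagueTendsto.eq {ι : Type*} {l : Filter ι} [l.NeBot] {m : ι → Measure X}
    {μ ν : Measure X} (hμ : μ ∈ RadonPos X) (hν : ν ∈ RadonPos X) (h : VagueTendsto m l μ)
    (h' : VagueTendsto m l ν) : μ = ν := by
  have := regular_of_mem_radonPos hμ
  have := regular_of_mem_radonPos hν
  exact Measure.ext_of_integral_eq_on_compactlySupported fun f =>
    tendsto_nhds_unique (h f f.continuous f.hasCompactSupport)
      (h' f f.continuous f.hasCompactSupport)

/-- The complement of `K` is open, so its mass cannot appear in a vague limit. -/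
theorem stronglyClosed_of_isCompact (hp : IsPerfect κ) {K : Set X} (hK : IsCompact K) :
    StronglyClosed κ K := by
  intro m hm μ hμ h
  have hv := h.vagueTendsto hp.consistency (fun n => (hm n).1) hμ hp.energy_principle
  refine ⟨hμ, le_antisymm ?_ bot_le⟩
  refine (hv.measure_le_liminf (fun n => (hm n).1.1) hμ.1 hK.isClosed.isOpen_compl).trans ?_
  simp [fun n => (hm n).2]

/-! ### Minimization of quadratic functionals -/

/-- The quadratic functional `‖μ‖² - 2 ∫ h dμ`. -/
noncomputable def quadFun (κ : X → X → ℝ≥0∞) (h : X → ℝ≥0∞) (μ : Measure X) : ℝ :=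
  pairing κ μ μ - 2 * (∫⁻ x, h x ∂μ).toReal

/-- Extracts the first variation: let t → 0 after dividing the increment by t. -/
theorem nonneg_of_forall_add_mul {a b : ℝ} (h : ∀ t ∈ Ioc (0 : ℝ) 1, 0 ≤ a + t * b) : 0 ≤ a := by
  have ht : Tendsto (fun t : ℝ => a + t * b) (𝓝[>] 0) (𝓝 (a + 0 * b)) :=
    tendsto_nhdsWithin_of_tendsto_nhds (Continuous.tendsto (by fun_prop) 0)
  rw [zero_mul, add_zero] at ht
  exact ge_of_tendsto ht (by
    filter_upwards [Ioc_mem_nhdsGT (zero_lt_one' ℝ)] with t ht using h t ht)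

/-- One expansion serves the midpoints, the perturbations μ + tτ and the shrinkings (1 - t)μ. -/
theorem quadFun_add_smul (hκ : IsKernel κ) (he : EnergyPrinciple κ) {h : X → ℝ≥0∞}
    {μ τ : Measure X} (hμ : μ ∈ FinEnergy κ) (hτ : τ ∈ FinEnergy κ) (hhμ : ∫⁻ x, h x ∂μ ≠ ∞)
    (hhτ : ∫⁻ x, h x ∂τ ≠ ∞) {s t : ℝ} (hs : 0 ≤ s) (ht : 0 ≤ t) :
    quadFun κ h (ENNReal.ofReal s • μ + ENNReal.ofReal t • τ) =
      s ^ 2 * pairing κ μ μ + 2 * (s * t) * pairing κ μ τ + t ^ 2 * pairing κ τ τ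
        - 2 * (s * (∫⁻ x, h x ∂μ).toReal + t * (∫⁻ x, h x ∂τ).toReal) := by
  have hμ' := smul_mem_finEnergy hκ (ENNReal.ofReal_ne_top (r := s)) hμ
  have hτ' := smul_mem_finEnergy hκ (ENNReal.ofReal_ne_top (r := t)) hτ
  rw [quadFun, pairing_add_left hκ he hμ' hτ' (add_mem_finEnergy hκ he hμ' hτ'),
    pairing_add_right hκ he hμ' hμ' hτ', pairing_add_right hκ he hτ' hμ' hτ',
    pairing_smul_left hκ hs _ hμ', pairing_smul_left hκ hs _ hτ', pairing_smul_left hκ ht _ hμ',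
    pairing_smul_left hκ ht _ hτ', pairing_smul_right hκ hs hμ hμ, pairing_smul_right hκ ht hμ hτ,
    pairing_smul_right hκ hs hτ hμ, pairing_smul_right hκ ht hτ hτ, pairing_comm hκ hτ hμ,
    lintegral_add_measure, lintegral_smul_measure, lintegral_smul_measure, smul_eq_mul,
    smul_eq_mul, ENNReal.toReal_add (ENNReal.mul_ne_top ENNReal.ofReal_ne_top hhμ)
    (ENNReal.mul_ne_top ENNReal.ofReal_ne_top hhτ), ENNReal.toReal_mul, ENNReal.toReal_mul,
    ENNReal.toReal_ofReal hs, ENNReal.toReal_ofReal ht]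
  ring

theorem exists_isMinOn_quadFun (hκ : IsKernel κ) (hp : IsPerfect κ) {B : Set X}
    (hB : StronglyClosed κ B) {h : X → ℝ≥0∞} (hfin : ∀ μ ∈ FinEnergyOn κ B, ∫⁻ x, h x ∂μ ≠ ∞)
    {c : ℝ} (hbdd : ∀ μ ∈ FinEnergyOn κ B, c ≤ quadFun κ h μ)
    (hcont : ∀ m : ℕ → Measure X, (∀ n, m n ∈ FinEnergyOn κ B) → ∀ μ ∈ FinEnergyOn κ B,
      StrongTendsto κ m atTop μ →
        Tendsto (fun n => (∫⁻ x, h x ∂(m n)).toReal) atTop (𝓝 (∫⁻ x, h x ∂μ).toReal)) :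
    ∃ μ ∈ FinEnergyOn κ B, ∀ τ ∈ FinEnergyOn κ B, quadFun κ h μ ≤ quadFun κ h τ := by
  have he := hp.energy_principle
  have hne : (quadFun κ h '' FinEnergyOn κ B).Nonempty := ⟨_, 0, zero_mem_finEnergyOn B, rfl⟩
  have hbd : BddBelow (quadFun κ h '' FinEnergyOn κ B) := ⟨c, by
    rintro _ ⟨μ, hμ, rfl⟩; exact hbdd μ hμ⟩
  set v := sInf (quadFun κ h '' FinEnergyOn κ B) with hv
  have hle : ∀ μ ∈ FinEnergyOn κ B, v ≤ quadFun κ h μ := fun μ hμ => csInf_le hbd ⟨μ, hμ, rfl⟩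
  have hex : ∀ n : ℕ, ∃ μ ∈ FinEnergyOn κ B, quadFun κ h μ < v + 1 / (n + 1) := by
    intro n
    obtain ⟨_, ⟨μ, hμ, rfl⟩, hlt⟩ := exists_lt_of_csInf_lt hne
      (show v < v + 1 / ((n : ℝ) + 1) by simp; positivity)
    exact ⟨μ, hμ, hlt⟩
  choose m hm hmv using hex
  have hlim : Tendsto (fun n => quadFun κ h (m n)) atTop (𝓝 v) := by
    refine tendsto_of_tendsto_of_tendsto_of_le_of_le tendsto_const_nhds ?_
      (fun n => hle _ (hm n)) (fun n => (hmv n).le)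
    simpa using tendsto_one_div_add_atTop_nhds_zero_nat.const_add v
  have hdist : ∀ i j, distSq κ (m i) (m j) ≤
      2 * (quadFun κ h (m i) - v) + 2 * (quadFun κ h (m j) - v) := by
    intro i j
    -- By the parallelogram identity the squared distance is 2J(m i) + 2J(m j) - 4J(midpoint) for J
    -- = `quadFun κ h`, and J(midpoint) ≥ v.
    have hmid := hle _ (add_mem_finEnergyOn hκ he
      (smul_mem_finEnergyOn hκ (ENNReal.ofReal_ne_top (r := 1 / 2)) (hm i))
      (smul_mem_finEnergyOn hκ (ENNReal.ofReal_ne_top (r := 1 / 2)) (hm j)))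
    rw [quadFun_add_smul hκ he (hm i).1 (hm j).1 (hfin _ (hm i)) (hfin _ (hm j)) (by norm_num)
      (by norm_num)] at hmid
    rw [distSq_eq, quadFun, quadFun]
    linarith
  obtain ⟨μ, hμ, hμlim⟩ := hp.consistency.complete m (fun n => (hm n).1) (by
    intro ε hε
    have hev := (tendsto_order.1 hlim).2 (v + ε / 4) (by linarith)
    obtain ⟨N, hN⟩ := eventually_atTop.1 hev
    refine ⟨N, fun i hi j hj => (hdist i j).trans_lt ?_⟩
    have := hN i hi
    have := hN j hj
    linarith)
  have hμB := hB m hm μ hμ hμlim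
  refine ⟨μ, hμB, fun τ hτ => ?_⟩
  have hconv : Tendsto (fun n => quadFun κ h (m n)) atTop (𝓝 (quadFun κ h μ)) :=
    (hμlim.pairing_self hκ he (fun n => (hm n).1) hμ).sub
      ((hcont m hm μ hμB hμlim).const_mul 2)
  rw [tendsto_nhds_unique hconv hlim]
  exact hle τ hτ

theorem ae_potential_of_isMinOn (hκ : IsKernel κ) (he : EnergyPrinciple κ) {B : Set X}
    {h : X → ℝ≥0∞} (hm : Measurable h) (hfin : ∀ μ ∈ FinEnergyOn κ B, ∫⁻ x, h x ∂μ ≠ ∞)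
    {μ : Measure X} (hμ : μ ∈ FinEnergyOn κ B)
    (hmin : ∀ τ ∈ FinEnergyOn κ B, quadFun κ h μ ≤ quadFun κ h τ) :
    (∀ τ ∈ FinEnergyOn κ B, ∀ᵐ x ∂τ, h x ≤ potential κ μ x) ∧
      ∀ᵐ x ∂μ, potential κ μ x = h x := by
  have hge : ∀ τ ∈ FinEnergyOn κ B, (∫⁻ x, h x ∂τ).toReal ≤ pairing κ τ μ := by
    intro τ hτ
    rw [pairing_comm hκ hτ.1 hμ.1]
    have : 0 ≤ 2 * (pairing κ μ τ - (∫⁻ x, h x ∂τ).toReal) := by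
      refine nonneg_of_forall_add_mul (b := pairing κ τ τ) fun t ht => ?_
      have h1 := hmin _ (add_mem_finEnergyOn hκ he
        (smul_mem_finEnergyOn hκ (ENNReal.ofReal_ne_top (r := 1)) hμ)
        (smul_mem_finEnergyOn hκ (ENNReal.ofReal_ne_top (r := t)) hτ))
      rw [quadFun_add_smul hκ he hμ.1 hτ.1 (hfin _ hμ) (hfin _ hτ) zero_le_one ht.1.le,
        quadFun] at h1
      have h2 : 0 ≤ t * (2 * (pairing κ μ τ - (∫⁻ x, h x ∂τ).toReal) + t * pairing κ τ τ) := by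
        linarith
      exact nonneg_of_mul_nonneg_right h2 ht.1
    linarith
  have hle : pairing κ μ μ ≤ (∫⁻ x, h x ∂μ).toReal := by
    have : 0 ≤ 2 * ((∫⁻ x, h x ∂μ).toReal - pairing κ μ μ) := by
      refine nonneg_of_forall_add_mul (b := pairing κ μ μ) fun t ht => ?_
      -- The variation (1 - t)μ; the second summand has coefficient 0 and only fits the shape of
      -- `quadFun_add_smul`.
      have h1 := hmin _ (add_mem_finEnergyOn hκ he
        (smul_mem_finEnergyOn hκ (ENNReal.ofReal_ne_top (r := 1 - t)) hμ)
        (smul_mem_finEnergyOn hκ (ENNReal.ofReal_ne_top (r := 0)) hμ))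
      rw [quadFun_add_smul hκ he hμ.1 hμ.1 (hfin _ hμ) (hfin _ hμ) (by linarith [ht.2]) le_rfl,
        quadFun] at h1
      have h2 : 0 ≤ t * (2 * ((∫⁻ x, h x ∂μ).toReal - pairing κ μ μ) + t * pairing κ μ μ) := by
        linarith
      exact nonneg_of_mul_nonneg_right h2 ht.1
    linarith
  have hfin' : ∀ τ ∈ FinEnergyOn κ B, ∫⁻ x, potential κ μ x ∂τ ≠ ∞ := fun τ hτ => by
    rw [← mutualEnergy_eq_lintegral hκ _ hμ.1.1]
    exact (mutualEnergy_lt_top he hτ.1 hμ.1).ne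
  have hae : ∀ τ ∈ FinEnergyOn κ B, ∀ᵐ x ∂τ, h x ≤ potential κ μ x := by
    intro τ hτ
    have := sigmaFinite_of_mem_radonPos hτ.1.1
    refine ae_le_of_forall_setLIntegral_le_of_sigmaFinite hm fun s hs _ => ?_
    -- The cone is stable under restriction, which localizes the integrated inequality.
    have hτs := restrict_mem_finEnergyOn hτ s
    rw [← ENNReal.toReal_le_toReal (hfin _ hτs) (hfin' _ hτs),
      ← mutualEnergy_eq_lintegral hκ _ hμ.1.1]
    exact hge _ hτs
  refine ⟨hae, ?_⟩
  have := ae_eq_of_ae_le_of_lintegral_le (hae μ hμ) (hfin μ hμ)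
    (measurable_potential hκ hμ.1.1).aemeasurable (by
      rw [← ENNReal.toReal_le_toReal (hfin' _ hμ) (hfin _ hμ),
        ← mutualEnergy_eq_lintegral hκ _ hμ.1.1]
      exact hle)
  filter_upwards [this] with x hx using hx.symm

/-! ### Compact sets -/

theorem measure_univ_eq {K : Set X} {μ : Measure X} (hμ : μ ∈ FinEnergyOn κ K) :
    μ univ = μ K := by
  refine le_antisymm ?_ (measure_mono (subset_univ _))
  rw [← union_compl_self K]
  exact (measure_union_le _ _).trans (by simp [hμ.2])

theorem measure_univ_lt_top {K : Set X} (hK : IsCompact K) {μ : Measure X}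
    (hμ : μ ∈ FinEnergyOn κ K) : μ univ < ∞ := by
  rw [measure_univ_eq hμ]
  exact hμ.1.1.lt_top_of_isCompact hK

/-- Compact sets have finite capacity. Otherwise unit measures on `K` with energies tending to 0
would converge strongly, hence vaguely, to 0, although a compactly supported function equal to 1 on
`K` always has integral 1. -/
theorem exists_sq_mass_le (hκ : IsKernel κ) (hp : IsPerfect κ) {K : Set X} (hK : IsCompact K) :
    ∃ C : ℝ, ∀ μ ∈ FinEnergyOn κ K, (μ univ).toReal ^ 2 ≤ C * pairing κ μ μ := by
  by_contra! hne
  choose m hm hlt using fun n : ℕ => hne (n + 1)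
  have h0 : ∀ n, 0 < (m n univ).toReal := by
    intro n
    refine ENNReal.toReal_nonneg.lt_of_ne fun h => ?_
    have := hlt n
    rw [← h] at this
    have := mul_nonneg (show 0 ≤ (n : ℝ) + 1 by positivity) (pairing_nonneg (κ := κ) (m n) (m n))
    linarith
  set ν : ℕ → Measure X := fun n => ENNReal.ofReal (m n univ).toReal⁻¹ • m n with hν
  have hνK : ∀ n, ν n ∈ FinEnergyOn κ K := fun n =>
    smul_mem_finEnergyOn hκ ENNReal.ofReal_ne_top (hm n)
  have hν1 : ∀ n, ν n univ = 1 := by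
    intro n
    rw [hν]
    simp only [Measure.smul_apply, smul_eq_mul]
    rw [ENNReal.ofReal_inv_of_pos (h0 n),
      ENNReal.ofReal_toReal (measure_univ_lt_top hK (hm n)).ne]
    exact ENNReal.inv_mul_cancel (fun h => by simpa [h] using h0 n)
      (measure_univ_lt_top hK (hm n)).ne
  have hνe : ∀ n, pairing κ (ν n) (ν n) ≤ 1 / ((n : ℝ) + 1) := by
    intro n
    rw [hν]
    simp only
    rw [pairing_smul_left hκ (inv_nonneg.2 (h0 n).le) _ (hνK n).1,
      pairing_smul_right hκ (inv_nonneg.2 (h0 n).le) (hm n).1 (hm n).1, ← mul_assoc,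
      le_div_iff₀ (by positivity), mul_assoc, mul_comm (pairing κ _ _), ← mul_inv, ← pow_two,
      inv_mul_le_iff₀ (pow_pos (h0 n) 2), mul_one]
    exact (hlt n).le
  have hs : StrongTendsto κ ν atTop 0 := by
    refine squeeze_zero (fun n => distSq_nonneg hp.energy_principle (hνK n).1
      (zero_mem_finEnergyOn K).1) (fun n => ?_) tendsto_one_div_add_atTop_nhds_zero_nat
    have : distSq κ (ν n) 0 = pairing κ (ν n) (ν n) := by
      simp [distSq_eq, pairing, mutualEnergy]
    rw [this]
    exact hνe n
  have hv := hs.vagueTendsto hp.consistency (fun n => (hνK n).1) (zero_mem_finEnergyOn K).1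
    hp.energy_principle
  obtain ⟨f, hf1, -, hfc, -⟩ := exists_continuous_one_zero_of_isCompact hK isClosed_empty
    (disjoint_empty K)
  have := hv f f.continuous hfc
  have h1 : ∀ n, ∫ x, f x ∂(ν n) = 1 := by
    intro n
    have : ∀ᵐ x ∂(ν n), f x = 1 := by
      have hae : ∀ᵐ x ∂(ν n), x ∈ K := (hνK n).2
      filter_upwards [hae] with x hx using hf1 hx
    rw [integral_congr_ae this]
    simp [Measure.real, hν1]
  simp [h1] at this

/-- Tietze extension times a cutoff turns `h` on `K` into a test function for vague convergence;
nothing changes for measures carried by `K`. -/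
theorem tendsto_lintegral_of_continuousOn (hp : IsPerfect κ)
    {K : Set X} (hK : IsCompact K) {h : X → ℝ≥0∞} (hh : ContinuousOn h K) (hm : Measurable h)
    (hfin : ∀ x ∈ K, h x ≠ ∞)
    {m : ℕ → Measure X} (hmK : ∀ n, m n ∈ FinEnergyOn κ K) {μ : Measure X}
    (hμ : μ ∈ FinEnergyOn κ K) (hlim : StrongTendsto κ m atTop μ) :
    Tendsto (fun n => (∫⁻ x, h x ∂(m n)).toReal) atTop (𝓝 (∫⁻ x, h x ∂μ).toReal) := by
  have hr : Continuous fun x : K => (h x).toReal := by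
    exact continuousOn_iff_continuous_domRestrict.1 (ENNReal.continuousOn_toReal.comp hh hfin)
  obtain ⟨g, hg⟩ := ContinuousMap.exists_extension hK.isClosed.isClosedEmbedding_subtypeVal
    (⟨_, hr⟩ : C(K, ℝ))
  obtain ⟨f, hf1, -, hfc, -⟩ := exists_continuous_one_zero_of_isCompact hK isClosed_empty
    (disjoint_empty K)
  have hint : ∀ ν ∈ FinEnergyOn κ K, (∫⁻ x, h x ∂ν).toReal = ∫ x, g x * f x ∂ν := by
    intro ν hν
    have hae : ∀ᵐ x ∂ν, x ∈ K := hν.2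
    rw [← integral_toReal hm.aemeasurable (by
      filter_upwards [hae] with x hx using (hfin x hx).lt_top)]
    refine integral_congr_ae ?_
    filter_upwards [hae] with x hx
    rw [hf1 hx, Pi.one_apply, mul_one]
    exact (congrArg (fun F : C(K, ℝ) => F ⟨x, hx⟩) hg).symm
  simp only [fun n => hint _ (hmK n), hint μ hμ]
  exact hlim.vagueTendsto hp.consistency (fun n => (hmK n).1) hμ.1 hp.energy_principle _
    (g.continuous.mul f.continuous) hfc.mul_left

/-- On a compact set `K`, every finite continuous function `h` is majorized nearly everywhere by
the potential of a measure on `K`, with equality almost everywhere for this measure. -/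
theorem exists_potential_of_continuousOn (hκ : IsKernel κ) (hp : IsPerfect κ) {K : Set X}
    (hK : IsCompact K) {h : X → ℝ≥0∞} (hh : ContinuousOn h K) (hm : Measurable h)
    {b : ℝ≥0∞} (hb : b ≠ ∞) (hhb : ∀ x ∈ K, h x ≤ b) :
    ∃ μ ∈ FinEnergyOn κ K, (∀ τ ∈ FinEnergyOn κ K, ∀ᵐ x ∂τ, h x ≤ potential κ μ x) ∧
      ∀ᵐ x ∂μ, potential κ μ x = h x := by
  have hle : ∀ μ ∈ FinEnergyOn κ K, ∫⁻ x, h x ∂μ ≤ b * μ univ := by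
    intro μ hμ
    have hae : ∀ᵐ x ∂μ, x ∈ K := hμ.2
    rw [← lintegral_const]
    exact lintegral_mono_ae (by filter_upwards [hae] with x hx using hhb x hx)
  have hfin : ∀ μ ∈ FinEnergyOn κ K, ∫⁻ x, h x ∂μ ≠ ∞ := fun μ hμ =>
    ((hle μ hμ).trans_lt (ENNReal.mul_lt_top hb.lt_top (measure_univ_lt_top hK hμ))).ne
  obtain ⟨C, hC⟩ := exists_sq_mass_le hκ hp hK
  -- The lower bound comes from completing the square: with mass t, t² ≤ D I(μ) and ∫ h dμ ≤ βt give
  -- D(I(μ) - 2βt + Dβ²) ≥ (t - Dβ)². Taking D = `max C 1` makes D positive.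
  obtain ⟨μ, hμ, hmin⟩ := exists_isMinOn_quadFun hκ hp (stronglyClosed_of_isCompact hp hK) hfin
    (c := - (max C 1 * b.toReal ^ 2)) (by
      intro μ hμ
      have h1 := ENNReal.toReal_mono
        (ENNReal.mul_ne_top hb (measure_univ_lt_top hK hμ).ne) (hle μ hμ)
      rw [ENNReal.toReal_mul] at h1
      have h2 := hC μ hμ
      have h3 : C * pairing κ μ μ ≤ max C 1 * pairing κ μ μ :=
        mul_le_mul_of_nonneg_right (le_max_left _ _) (pairing_nonneg _ _)
      have hC1 : 0 < max C 1 := lt_max_of_lt_right one_pos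
      rw [quadFun]
      generalize max C 1 = D at *
      generalize (μ univ).toReal = t at *
      generalize b.toReal = β at *
      have h4 : 0 ≤ D * (pairing κ μ μ - 2 * (β * t) + D * β ^ 2) := by
        have := sq_nonneg (t - D * β)
        nlinarith
      have h5 := nonneg_of_mul_nonneg_right h4 hC1
      linarith)
    (fun m hmK μ hμ hlim => tendsto_lintegral_of_continuousOn hp hK hh hm
      (fun x hx => ((hhb x hx).trans_lt hb.lt_top).ne) hmK hμ hlim)
  exact ⟨μ, hμ, ae_potential_of_isMinOn hκ hp.energy_principle hm hfin hμ hmin⟩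

/-! ### Swept measures -/

theorem NearlyEverywhereOn.mono {A B : Set X} {P : X → Prop} (h : NearlyEverywhereOn κ B P)
    (hAB : A ⊆ B) : NearlyEverywhereOn κ A P := by
  refine le_antisymm (le_trans ?_ (le_of_eq h)) bot_le
  exact biSup_mono fun K hK => ⟨hK.1, hK.2.trans fun x hx => ⟨hAB hx.1, hx.2⟩⟩

theorem NearlyEverywhereOn.imp {A : Set X} {P Q : X → Prop} (h : NearlyEverywhereOn κ A P)
    (hPQ : ∀ x, P x → Q x) : NearlyEverywhereOn κ A Q := by
  refine le_antisymm (le_trans ?_ (le_of_eq h)) bot_le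
  exact biSup_mono fun K hK => ⟨hK.1, hK.2.trans fun x hx => ⟨hx.1, fun hP => hx.2 (hPQ x hP)⟩⟩

theorem IsSwept.ae_eq (hκ : IsKernel κ) {A : Set X} {ω ν τ : Measure X} (hω : ω ∈ RadonPos X)
    (h : IsSwept κ A ω ν) (hτ : τ ∈ FinEnergyOn κ A) :
    ∀ᵐ x ∂τ, potential κ ν x = potential κ ω x :=
  ae_of_nearlyEverywhereOn hκ (measurableSet_eq_fun (measurable_potential hκ h.1.1.1)
    (measurable_potential hκ hω)) h.2 hτ

theorem IsSwept.lintegral_eq (hκ : IsKernel κ) {A : Set X} {ω ν τ : Measure X}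
    (hω : ω ∈ RadonPos X) (h : IsSwept κ A ω ν) (hτ : τ ∈ FinEnergyOn κ A) :
    ∫⁻ x, potential κ ν x ∂τ = ∫⁻ x, potential κ ω x ∂τ :=
  lintegral_congr_ae (h.ae_eq hκ hω hτ)

theorem isSwept_self {A : Set X} {ω : Measure X} (hω : ω ∈ FinEnergyOn κ A) :
    IsSwept κ A ω ω :=
  ⟨hω, nearlyEverywhereOn_of_ae fun _ _ _ _ _ => Eventually.of_forall fun _ => rfl⟩

theorem eq_of_mutualEnergy_eq (he : EnergyPrinciple κ) {μ ν : Measure X} (hμ : μ ∈ FinEnergy κ)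
    (hν : ν ∈ FinEnergy κ) (h : mutualEnergy κ μ ν = energy κ μ)
    (h' : mutualEnergy κ μ ν = energy κ ν) : μ = ν :=
  (he μ hμ ν hν).2 (by rw [two_mul, ← h, ← h'])

/-- Testing with μ and ν themselves gives I(μ, ν) = I(μ) = I(ν), that is, ‖μ - ν‖ = 0. -/
theorem eq_of_lintegral_potential_eq (hκ : IsKernel κ) (he : EnergyPrinciple κ) {A : Set X}
    {μ ν : Measure X} (hμ : μ ∈ FinEnergyOn κ A) (hν : ν ∈ FinEnergyOn κ A)
    (h : ∀ τ ∈ FinEnergyOn κ A, ∫⁻ x, potential κ μ x ∂τ = ∫⁻ x, potential κ ν x ∂τ) : μ = ν := by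
  refine eq_of_mutualEnergy_eq he hμ.1 hν.1 ?_ ?_
  · rw [energy, mutualEnergy_eq_lintegral hκ _ hν.1.1, mutualEnergy_eq_lintegral hκ _ hμ.1.1,
      h μ hμ]
  · rw [mutualEnergy_comm hκ hμ.1.1 hν.1.1, energy, mutualEnergy_eq_lintegral hκ _ hν.1.1,
      mutualEnergy_eq_lintegral hκ _ hμ.1.1, h ν hν]

theorem IsSwept.unique (hκ : IsKernel κ) (he : EnergyPrinciple κ) {A : Set X} {ω μ ν : Measure X}
    (hω : ω ∈ RadonPos X) (hμ : IsSwept κ A ω μ) (hν : IsSwept κ A ω ν) : μ = ν :=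
  eq_of_lintegral_potential_eq hκ he hμ.1 hν.1 fun _ hτ =>
    (hμ.lintegral_eq hκ hω hτ).trans (hν.lintegral_eq hκ hω hτ).symm

/-- Both n.e. relations hold ν-a.e., since ν has finite energy and lives on `A`; domination spreads
the inequality to all of X. -/
theorem IsSwept.potential_le (hκ : IsKernel κ) (hdom : DominationPrinciple κ) {A : Set X}
    {ω ν ν' : Measure X} (hω : ω ∈ RadonPos X) (h : IsSwept κ A ω ν) (hν' : ν' ∈ Dominating κ A ω)
    (x : X) : potential κ ν x ≤ potential κ ν' x := by
  refine hdom ν h.1.1 ν' hν'.1 ?_ x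
  filter_upwards [h.ae_eq hκ hω h.1, ae_of_nearlyEverywhereOn hκ (measurableSet_le
    (measurable_potential hκ hω) (measurable_potential hκ hν'.1)) hν'.2 h.1] with x hx hx'
  exact hx.trans_le hx'

theorem IsSwept.mem_dominating {A B : Set X} {ω ν : Measure X} (h : IsSwept κ B ω ν)
    (hAB : A ⊆ B) : ν ∈ Dominating κ A ω :=
  ⟨h.1.1.1, (h.2.imp fun _ hx => hx.ge).mono hAB⟩

/-- Equality μ-a.e. becomes U^μ ≤ U^ω everywhere by domination, which complements the lower bound.
-/
theorem exists_isSwept_of_potential (hdom : DominationPrinciple κ)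
    {B : Set X} {ω : Measure X} (hω : ω ∈ RadonPos X)
    (h : ∃ μ ∈ FinEnergyOn κ B,
      (∀ τ ∈ FinEnergyOn κ B, ∀ᵐ x ∂τ, potential κ ω x ≤ potential κ μ x) ∧
        ∀ᵐ x ∂μ, potential κ μ x = potential κ ω x) :
    ∃ μ, IsSwept κ B ω μ := by
  obtain ⟨μ, hμ, hge, heq⟩ := h
  have hle := hdom μ hμ.1 ω hω (by filter_upwards [heq] with x hx using hx.le)
  refine ⟨μ, hμ, nearlyEverywhereOn_of_ae fun K _ hKB τ hτ => ?_⟩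
  filter_upwards [hge τ (finEnergyOn_mono hKB hτ)] with x hx using le_antisymm (hle x) hx

/-- Here the functional is ‖μ - ω‖² - ‖ω‖², bounded below by -‖ω‖² and strongly continuous. -/
theorem exists_isSwept_of_finEnergy (hκ : IsKernel κ) (hp : IsPerfect κ)
    (hdom : DominationPrinciple κ) {B : Set X} (hB : StronglyClosed κ B) {ω : Measure X}
    (hω : ω ∈ FinEnergy κ) : ∃ μ, IsSwept κ B ω μ := by
  have he := hp.energy_principle
  have hL : ∀ μ : Measure X, (∫⁻ x, potential κ ω x ∂μ).toReal = pairing κ μ ω := fun μ => by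
    rw [pairing, mutualEnergy_eq_lintegral hκ _ hω.1]
  have hfin : ∀ μ ∈ FinEnergyOn κ B, ∫⁻ x, potential κ ω x ∂μ ≠ ∞ := fun μ hμ => by
    rw [← mutualEnergy_eq_lintegral hκ _ hω.1]
    exact (mutualEnergy_lt_top he hμ.1 hω).ne
  obtain ⟨μ, hμ, hmin⟩ := exists_isMinOn_quadFun hκ hp hB hfin (c := - pairing κ ω ω)
    (fun μ hμ => by
      have := distSq_nonneg he hμ.1 hω
      rw [distSq_eq] at this
      rw [quadFun, hL]
      linarith)
    (fun m hm μ hμ hlim => by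
      simp only [hL]
      exact hlim.pairing hκ he (fun n => (hm n).1) hμ.1 hω)
  exact exists_isSwept_of_potential hdom hω.1
    ⟨μ, hμ, ae_potential_of_isMinOn hκ he (measurable_potential hκ hω.1) hfin hμ hmin⟩

theorem exists_isSwept_of_isCompact (hκ : IsKernel κ) (hp : IsPerfect κ)
    (hdom : DominationPrinciple κ) {K : Set X} (hK : IsCompact K) {ω : Measure X}
    (hω : ω ∈ RadonPos X) (hcont : ContinuousOn (potential κ ω) K) {b : ℝ≥0∞} (hb : b ≠ ∞)
    (hle : ∀ x ∈ K, potential κ ω x ≤ b) : ∃ μ, IsSwept κ K ω μ :=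
  exists_isSwept_of_potential hdom hω
    (exists_potential_of_continuousOn hκ hp hK hcont (measurable_potential hκ hω) hb hle)

/-- The equilibrium-type measure γ of `K` has U^γ ≥ 1 ν-a.e. and U^γ ≤ M on X, so exchanging
integrals bounds the mass of ν by M ω(X). The point is that `M` does not depend on `K`. -/
theorem UgaheriPrinciple.exists_energy_le (hug : UgaheriPrinciple κ) (hκ : IsKernel κ)
    (hp : IsPerfect κ) : ∃ M : ℝ≥0∞, M ≠ ∞ ∧ ∀ K : Set X, IsCompact K →
      ∀ ω ∈ RadonPos X, ∀ b : ℝ≥0∞, (∀ x ∈ K, potential κ ω x ≤ b) →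
        ∀ ν, IsSwept κ K ω ν → energy κ ν ≤ b * (M * ω univ) := by
  obtain ⟨M, -, hM⟩ := hug
  -- The factor 1 is the level c at which the maximum principle is applied to γ.
  refine ⟨ENNReal.ofReal (M * 1), ENNReal.ofReal_ne_top, fun K hK ω hω b hb ν hν => ?_⟩
  obtain ⟨γ, hγ, hγ1, hγ2⟩ := exists_potential_of_continuousOn hκ hp hK (h := fun _ => 1)
    continuousOn_const measurable_const (b := 1) ENNReal.one_ne_top (fun _ _ => le_rfl)
  have hγM := hM γ hγ.1 1 one_pos (by filter_upwards [hγ2] with x hx using by simp [hx])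
  have hmass : ν univ ≤ ENNReal.ofReal (M * 1) * ω univ :=
    calc ν univ = ∫⁻ _, 1 ∂ν := lintegral_one.symm
      _ ≤ ∫⁻ x, potential κ γ x ∂ν := lintegral_mono_ae (hγ1 ν hν.1)
      _ = ∫⁻ x, potential κ ν x ∂γ := lintegral_potential_comm hκ hν.1.1.1 hγ.1.1
      _ = ∫⁻ x, potential κ ω x ∂γ := hν.lintegral_eq hκ hω hγ
      _ = ∫⁻ x, potential κ γ x ∂ω := lintegral_potential_comm hκ hγ.1.1 hω
      _ ≤ ∫⁻ _, ENNReal.ofReal (M * 1) ∂ω := lintegral_mono hγM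
      _ = _ := lintegral_const _
  have hae : ∀ᵐ x ∂ν, x ∈ K := hν.1.2
  calc energy κ ν = ∫⁻ x, potential κ ω x ∂ν := by
        rw [energy, mutualEnergy_eq_lintegral hκ _ hν.1.1.1, hν.lintegral_eq hκ hω hν.1]
    _ ≤ ∫⁻ _, b ∂ν := lintegral_mono_ae (by filter_upwards [hae] with x hx using hb x hx)
    _ = b * ν univ := lintegral_const _
    _ ≤ _ := by gcongr

/-! ### Exhaustion by compact subsets -/

/-- Both potentials equal U^ω μ-a.e. Hence squared distances between nested swept measures are
differences of energies, and energy increases with the set. -/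
theorem IsSwept.mutualEnergy_eq (hκ : IsKernel κ) {A B : Set X} {ω μ ν : Measure X}
    (hω : ω ∈ RadonPos X) (hμ : IsSwept κ A ω μ) (hν : IsSwept κ B ω ν) (hAB : A ⊆ B) :
    mutualEnergy κ μ ν = energy κ μ := by
  rw [energy, mutualEnergy_eq_lintegral hκ _ hν.1.1.1, mutualEnergy_eq_lintegral hκ _ hμ.1.1.1,
    hμ.lintegral_eq hκ hω hμ.1, hν.lintegral_eq hκ hω (finEnergyOn_mono hAB hμ.1)]

theorem IsSwept.distSq_eq (hκ : IsKernel κ) {A B : Set X} {ω μ ν : Measure X}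
    (hω : ω ∈ RadonPos X) (hμ : IsSwept κ A ω μ) (hν : IsSwept κ B ω ν) (hAB : A ⊆ B) :
    distSq κ μ ν = pairing κ ν ν - pairing κ μ μ := by
  rw [Balayage.distSq_eq, pairing, pairing, pairing, hμ.mutualEnergy_eq hκ hω hν hAB, energy]
  ring

theorem exists_isSwept_of_forall_compact (hκ : IsKernel κ) (hp : IsPerfect κ) {A : Set X}
    (hA : StronglyClosed κ A) {ω : Measure X} (hω : ω ∈ RadonPos X)
    {w : CompactSub A → Measure X} (hw : ∀ K : CompactSub A, IsSwept κ (K : Set X) ω (w K))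
    {S : ℝ} (hS : ∀ K, pairing κ (w K) (w K) ≤ S) : ∃ ν, IsSwept κ A ω ν := by
  have he := hp.energy_principle
  set e : CompactSub A → ℝ := fun K => pairing κ (w K) (w K) with hedef
  have hbdd : BddAbove (range e) := ⟨S, by rintro _ ⟨K, rfl⟩; exact hS K⟩
  have hne : (range e).Nonempty := ⟨_, ⟨∅, isCompact_empty, empty_subset _⟩, rfl⟩
  set s := sSup (range e) with hs
  have hle : ∀ K, e K ≤ s := fun K => le_csSup hbdd ⟨K, rfl⟩
  have hdist : ∀ {K L : CompactSub A}, K ≤ L → distSq κ (w K) (w L) ≤ s - e K := by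
    intro K L hKL
    rw [(hw K).distSq_eq hκ hω (hw L) hKL]
    have := hle L
    simp only [hedef] at this ⊢
    linarith
  have hmono : ∀ {K L : CompactSub A}, K ≤ L → e K ≤ e L := by
    intro K L hKL
    have := distSq_nonneg he (hw K).1.1 (hw L).1.1
    rw [(hw K).distSq_eq hκ hω (hw L) hKL] at this
    simp only [hedef]
    linarith
  have hex : ∀ n : ℕ, ∃ K, s - 1 / ((n : ℝ) + 1) < e K := by
    intro n
    obtain ⟨_, ⟨K, rfl⟩, h⟩ := exists_lt_of_lt_csSup hne
      (show s - 1 / ((n : ℝ) + 1) < s by simp; positivity)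
    exact ⟨K, h⟩
  choose L hL using hex
  -- Finite unions make the sequence increasing; by monotonicity the energies still approach the
  -- supremum `s`.
  let K : ℕ → CompactSub A := fun n => ⟨accumulate (fun i => (L i : Set X)) n,
    isCompact_accumulate (fun i => (L i).2.1) n,
    iUnion₂_subset fun i _ => (L i).2.2⟩
  have hKmono : ∀ {i j : ℕ}, i ≤ j → K i ≤ K j := fun hij => monotone_accumulate hij
  have hLK : ∀ n, L n ≤ K n := fun n => subset_accumulate (s := fun i => (L i : Set X))
  have hgap : ∀ n, s - e (K n) ≤ 1 / ((n : ℝ) + 1) := by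
    intro n
    have := hmono (hLK n)
    have := hL n
    linarith
  have hdsymm : ∀ K L, distSq κ (w K) (w L) = distSq κ (w L) (w K) := by
    intro K L
    rw [distSq_eq, distSq_eq, pairing_comm hκ (hw K).1.1 (hw L).1.1]
    ring
  obtain ⟨ν, hν, hlim⟩ := hp.consistency.complete (fun n => w (K n)) (fun n => (hw _).1.1) (by
    intro ε hε
    obtain ⟨N, hN⟩ := exists_nat_one_div_lt hε
    have hkey : ∀ i j, N ≤ i → i ≤ j → distSq κ (w (K i)) (w (K j)) < ε := by
      intro i j hi hij
      have h1 := hdist (hKmono hij)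
      have h2 := hgap i
      have h3 : 1 / ((i : ℝ) + 1) ≤ 1 / ((N : ℝ) + 1) :=
        one_div_le_one_div_of_le (by positivity) (by simpa using hi)
      linarith
    refine ⟨N, fun i hi j hj => ?_⟩
    rcases le_total i j with h | h
    · exact hkey i j hi h
    · rw [hdsymm]
      exact hkey j i hj h)
  have hνA := hA _ (fun n => finEnergyOn_mono (K n).2.2 (hw (K n)).1) ν hν hlim
  have hint : ∀ Q : CompactSub A, ∀ μ ∈ FinEnergyOn κ (Q : Set X),
      ∫⁻ x, potential κ ν x ∂μ = ∫⁻ x, potential κ ω x ∂μ := by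
    intro Q μ hμ
    -- Sweeping onto `K n ∪ Q` integrates against μ exactly as U^ω does, while staying strongly
    -- close to `w (K n)`.
    let K' : ℕ → CompactSub A := fun n => ⟨K n ∪ Q, (K n).2.1.union Q.2.1,
      union_subset (K n).2.2 Q.2.2⟩
    have hKK' : ∀ n, K n ≤ K' n := fun n => subset_union_left (s := (K n : Set X))
    have hQK' : ∀ n, (Q : Set X) ⊆ K' n := fun n => subset_union_right
    have hpair : ∀ ρ : Measure X, ρ ∈ FinEnergy κ →
        pairing κ ρ μ = (∫⁻ x, potential κ ρ x ∂μ).toReal := fun ρ hρ => by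
      rw [pairing, mutualEnergy_comm hκ hρ.1 hμ.1.1, mutualEnergy_eq_lintegral hκ _ hρ.1]
    have h1 : ∀ n, pairing κ (w (K' n)) μ = (∫⁻ x, potential κ ω x ∂μ).toReal := fun n => by
      rw [hpair _ (hw _).1.1, (hw (K' n)).lintegral_eq hκ hω (finEnergyOn_mono (hQK' n) hμ)]
    have h2 := hlim.pairing hκ he (fun n => (hw _).1.1) hν hμ.1
    have h3 : Tendsto (fun n => (pairing κ (w (K n)) μ - pairing κ (w (K' n)) μ) ^ 2) atTop
        (𝓝 0) := by
      refine squeeze_zero (fun _ => sq_nonneg _) (fun n => ?_)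
        (by simpa using tendsto_one_div_add_atTop_nhds_zero_nat.mul_const (pairing κ μ μ))
      exact (sq_pairing_sub_le hκ he (hw _).1.1 (hw _).1.1 hμ.1).trans
        (mul_le_mul_of_nonneg_right ((hdist (hKK' n)).trans (by simpa using hgap n)) (pairing_nonneg _ _))
    simp only [h1] at h3
    have h4 := tendsto_nhds_unique h3
      ((h2.sub_const (∫⁻ x, potential κ ω x ∂μ).toReal).pow 2)
    have h5 : pairing κ ν μ = (∫⁻ x, potential κ ω x ∂μ).toReal := by
      have := pow_eq_zero_iff (two_ne_zero) |>.1 h4.symm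
      linarith
    rw [hpair ν hν] at h5
    refine (ENNReal.toReal_eq_toReal_iff' ?_ ?_).1 h5
    · rw [← mutualEnergy_eq_lintegral hκ _ hν.1]
      exact (mutualEnergy_lt_top he hμ.1 hν).ne
    · rw [← (hw Q).lintegral_eq hκ hω hμ, ← mutualEnergy_eq_lintegral hκ _ (hw Q).1.1.1]
      exact (mutualEnergy_lt_top he hμ.1 (hw Q).1.1).ne
  refine ⟨ν, hνA, nearlyEverywhereOn_of_ae fun Q hQ hQA μ hμ => ?_⟩
  have := sigmaFinite_of_mem_radonPos hμ.1.1
  exact ae_eq_of_forall_setLIntegral_eq_of_sigmaFinite (measurable_potential hκ hν.1)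
    (measurable_potential hκ hω) fun t _ _ =>
      hint ⟨Q, hQ, hQA⟩ _ (restrict_mem_finEnergyOn hμ t)

/-- Inner regularity of the finite measure with density `f`. -/
theorem exists_compact_lt_setLIntegral {A : Set X} {μ : Measure X} (hμA : μ Aᶜ = 0)
    {f : X → ℝ≥0∞} (hfin : ∫⁻ x, f x ∂μ ≠ ∞) {r : ℝ≥0∞} (hr : r < ∫⁻ x, f x ∂μ) :
    ∃ K : CompactSub A, r < ∫⁻ x in K, f x ∂μ := by
  have : IsFiniteMeasure (μ.withDensity f) := isFiniteMeasure_withDensity hfin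
  have hB := (measurableSet_toMeasurable μ Aᶜ).compl
  have hr' : r < μ.withDensity f (toMeasurable μ Aᶜ)ᶜ := by
    rwa [withDensity_apply _ hB, Measure.restrict_eq_self_of_ae_mem]
    exact (by simpa using hμA : μ (toMeasurable μ Aᶜ)ᶜᶜ = 0)
  obtain ⟨K, hKB, hK, hlt⟩ := hB.exists_lt_isCompact hr'
  refine ⟨⟨K, hK, hKB.trans (compl_subset_comm.1 (subset_toMeasurable μ Aᶜ))⟩, ?_⟩
  rwa [withDensity_apply _ hK.measurableSet] at hlt

/-- Since ‖ω^K - ν‖² = ‖ν‖² - ‖ω^K‖², only energies matter. They satisfy I(ω^K) = I(ω^K, ν) ≥ ∫_K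
U^ω dν, and these integrals exhaust ∫ U^ω dν = I(ν). -/
theorem IsSwept.strongTendsto (hκ : IsKernel κ) (he : EnergyPrinciple κ) {A : Set X}
    {ω ν : Measure X} (hω : ω ∈ RadonPos X) (hν : IsSwept κ A ω ν)
    {w : CompactSub A → Measure X} (hw : ∀ K : CompactSub A, IsSwept κ (K : Set X) ω (w K)) :
    StrongTendsto κ w atTop ν := by
  have hd : ∀ K, distSq κ (w K) ν = pairing κ ν ν - pairing κ (w K) (w K) := fun K =>
    (hw K).distSq_eq hκ hω hν K.2.2
  have hen : energy κ ν = ∫⁻ x, potential κ ω x ∂ν := by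
    rw [energy, mutualEnergy_eq_lintegral hκ _ hν.1.1.1, hν.lintegral_eq hκ hω hν.1]
  have hbound : ∀ K : CompactSub A, ∫⁻ x in K, potential κ ω x ∂ν ≤ energy κ (w K) := by
    intro K
    have hτ := restrict_mem_finEnergyOn_self hν.1.1 K.2.1.measurableSet
    rw [← (hw K).lintegral_eq hκ hω hτ, ← (hw K).mutualEnergy_eq hκ hω hν K.2.2,
      mutualEnergy_comm hκ (hw K).1.1.1 hν.1.1.1, mutualEnergy_eq_lintegral hκ _ (hw K).1.1.1]
    exact setLIntegral_le_lintegral _ _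
  rw [StrongTendsto, tendsto_order]
  refine ⟨fun a ha => Eventually.of_forall fun K =>
    ha.trans_le (distSq_nonneg he (hw K).1.1 hν.1.1), fun a ha => ?_⟩
  have hex : ∃ K₀ : CompactSub A, pairing κ ν ν - a < pairing κ (w K₀) (w K₀) := by
    rcases lt_or_ge (pairing κ ν ν - a) 0 with h | h
    · exact ⟨⟨∅, isCompact_empty, empty_subset _⟩, h.trans_le (pairing_nonneg _ _)⟩
    · obtain ⟨K₀, hK₀⟩ := exists_compact_lt_setLIntegral hν.1.2 (f := potential κ ω)
        (r := ENNReal.ofReal (pairing κ ν ν - a)) (hen ▸ hν.1.1.2.ne) (by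
          rw [← hen, ENNReal.ofReal_lt_iff_lt_toReal h hν.1.1.2.ne]
          simp only [pairing, energy]
          linarith)
      refine ⟨K₀, (ENNReal.ofReal_lt_iff_lt_toReal h (hw K₀).1.1.2.ne).1 ?_⟩
      exact hK₀.trans_le (hbound K₀)
  obtain ⟨K₀, hK₀⟩ := hex
  filter_upwards [eventually_ge_atTop K₀] with K hK
  have h1 := distSq_nonneg he (hw K₀).1.1 (hw K).1.1
  rw [(hw K₀).distSq_eq hκ hω (hw K) hK] at h1
  rw [hd]
  linarith

instance (A : Set X) : Nonempty (CompactSub A) := ⟨⟨∅, isCompact_empty, empty_subset _⟩⟩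

/-- Together with nonemptiness this makes `atTop` nontrivial, so limits along it are unique. -/
instance (A : Set X) : IsDirectedOrder (CompactSub A) :=
  ⟨fun K L => ⟨⟨K ∪ L, K.2.1.union L.2.1, union_subset K.2.2 L.2.2⟩,
    subset_union_left (s := (K : Set X)), subset_union_right (s := (K : Set X))⟩⟩

theorem IsKernel.lowerSemicontinuous_right (hκ : IsKernel κ) (x : X) :
    LowerSemicontinuous (κ x) :=
  hκ.lsc.comp (Continuous.prodMk_right x)

theorem IsSwept.monotone_potential (hκ : IsKernel κ) (hdom : DominationPrinciple κ) {A : Set X}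
    {ω : Measure X} (hω : ω ∈ RadonPos X)
    {w : CompactSub A → Measure X} (hw : ∀ K : CompactSub A, IsSwept κ (K : Set X) ω (w K))
    (x : X) : Monotone fun K : CompactSub A => potential κ (w K) x := fun K L hKL =>
  (hw K).potential_le hκ hdom hω ((hw L).mem_dominating hKL) x

/-- Domination gives monotonicity and the upper bound U^ν; the lower bound is semicontinuity of κ(x,
·) along a strongly convergent sequence of the ω^K. -/
theorem IsSwept.tendsto_potential (hκ : IsKernel κ) (hp : IsPerfect κ)
    (hdom : DominationPrinciple κ) {A : Set X} {ω ν : Measure X} (hω : ω ∈ RadonPos X)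
    (hν : IsSwept κ A ω ν)
    {w : CompactSub A → Measure X} (hw : ∀ K : CompactSub A, IsSwept κ (K : Set X) ω (w K))
    (x : X) :
    Tendsto (fun K : CompactSub A => potential κ (w K) x) atTop (𝓝 (potential κ ν x)) := by
  have hst := hν.strongTendsto hκ hp.energy_principle hω hw
  convert tendsto_atTop_iSup (IsSwept.monotone_potential hκ hdom hω hw x) using 2
  refine le_antisymm ?_ (iSup_le fun K => (hw K).potential_le hκ hdom hω
    (hν.mem_dominating K.2.2) x)
  have hex : ∀ n : ℕ, ∃ K, distSq κ (w K) ν < 1 / ((n : ℝ) + 1) := fun n =>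
    ((tendsto_order.1 hst).2 (1 / ((n : ℝ) + 1)) (by positivity)).exists
  choose K hK using hex
  have hst' : StrongTendsto κ (fun n => w (K n)) atTop ν :=
    squeeze_zero (fun n => distSq_nonneg hp.energy_principle (hw _).1.1 hν.1.1)
      (fun n => (hK n).le) tendsto_one_div_add_atTop_nhds_zero_nat
  have hv := hst'.vagueTendsto hp.consistency (fun n => (hw _).1.1) hν.1.1 hp.energy_principle
  refine (hv.lintegral_le_liminf (fun n => (hw _).1.1.1) hν.1.1.1
    (hκ.lowerSemicontinuous_right x)).trans ?_
  refine liminf_le_of_le (by isBoundedDefault) fun b hb => ?_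
  obtain ⟨n, hn⟩ := hb.exists
  exact hn.trans (le_iSup (fun K => potential κ (w K) x) (K n))

end Balayage

/-! ### The characterizations of the inner balayage -/

theorem theorem1p1 {X : Type*} [TopologicalSpace X] [T2Space X] [LocallyCompactSpace X]
    [SecondCountableTopology X] [MeasurableSpace X] [BorelSpace X]
    (κ : X → X → ℝ≥0∞) (hκ : IsKernel κ) (hperf : IsPerfect κ)
    (hdom : DominationPrinciple κ) (hug : UgaheriPrinciple κ)
    (A : Set X) (hA : 0 < innerCapacity κ A) (hclosed : StronglyClosed κ A)
    (ω : Measure X) (hω : ω ∈ RadonPos X) (hω0 : ω ≠ 0)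
    (hcase : ω ∈ FinEnergy κ ∨
      (ω univ < ∞ ∧
        (∀ K : Set X, IsCompact K → K ⊆ A → ContinuousOn (potential κ ω) K) ∧
        ⨆ x ∈ A, potential κ ω x < ∞)) :
    -- existence and uniqueness of the auxiliary measures `σ^A` and `ω^K`
    (∀ σ ∈ FinEnergy κ, ∃! σ' : Measure X, IsSwept κ A σ σ') ∧
    (∀ K : CompactSub A, ∃! ν : Measure X, IsSwept κ (K : Set X) ω ν) ∧
    -- the inner balayage `ωA`; each line `∀ μ, ... ↔ μ = ωA` says that `ωA` is the only measure
    -- with the property on the left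
    ∃ ωA : Measure X,
      -- (i)
      (∀ μ, (μ ∈ FinEnergyOn κ A ∧
          NearlyEverywhereOn κ A fun x => potential κ μ x = potential κ ω x) ↔ μ = ωA) ∧
      (∀ μ, (μ ∈ FinEnergyOn κ A ∧ ∀ τ ∈ FinEnergyOn κ A,
          ∫⁻ x, potential κ μ x ∂τ = ∫⁻ x, potential κ ω x ∂τ) ↔ μ = ωA) ∧
      -- (ii)
      (∀ μ, (μ ∈ FinEnergyOn κ A ∧ ∀ σ ∈ FinEnergy κ, ∀ σA, IsSwept κ A σ σA →
          ∫⁻ x, potential κ μ x ∂σ = ∫⁻ x, potential κ ω x ∂σA) ↔ μ = ωA) ∧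
      -- (iii)
      (∀ ωK : CompactSub A → Measure X, (∀ K : CompactSub A, IsSwept κ (K : Set X) ω (ωK K)) →
        (∀ μ, (μ ∈ FinEnergyOn κ A ∧ StrongTendsto κ ωK atTop μ) ↔ μ = ωA) ∧
        (∀ μ, (μ ∈ FinEnergyOn κ A ∧ VagueTendsto ωK atTop μ) ↔ μ = ωA) ∧
        (∀ μ, (μ ∈ FinEnergyOn κ A ∧
            ∀ x, Monotone (fun K : CompactSub A => potential κ (ωK K) x) ∧
              Tendsto (fun K : CompactSub A => potential κ (ωK K) x) atTop
                (𝓝 (potential κ μ x))) ↔ μ = ωA)) ∧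
      -- (iv)
      (∀ μ, (μ ∈ FinEnergyField κ A ω ∧
          ∀ τ ∈ FinEnergyField κ A ω, gauss κ ω μ ≤ gauss κ ω τ) ↔ μ = ωA) ∧
      ((gauss κ ω ωA : EReal) = gaussInf κ A ω ∧ ⊥ < gaussInf κ A ω ∧ gaussInf κ A ω ≤ 0) ∧
      -- (v)
      (∀ μ, (μ ∈ Dominating κ A ω ∧ μ ∈ FinEnergy κ ∧
          ∀ ν ∈ Dominating κ A ω, ∀ x, potential κ μ x ≤ potential κ ν x) ↔ μ = ωA) ∧
      -- (vi)
      (∀ μ, (μ ∈ Dominating κ A ω ∧ μ ∈ FinEnergy κ ∧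
          ∀ ν ∈ Dominating κ A ω, energy κ μ ≤ energy κ ν) ↔ μ = ωA) := by
  have he := hperf.energy_principle
  have hcl : ∀ K : CompactSub A, StronglyClosed κ (K : Set X) := fun K =>
    stronglyClosed_of_isCompact hperf K.2.1
  have hexK : ∀ K : CompactSub A, ∃ ν, IsSwept κ (K : Set X) ω ν := by
    intro K
    rcases hcase with h | ⟨-, hcont, hsup⟩
    · exact exists_isSwept_of_finEnergy hκ hperf hdom (hcl K) h
    · exact exists_isSwept_of_isCompact hκ hperf hdom K.2.1 hω (hcont K K.2.1 K.2.2) hsup.ne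
        fun x hx => le_iSup₂ (f := fun x (_ : x ∈ A) => potential κ ω x) x (K.2.2 hx)
  have hexA : ∃ ν, IsSwept κ A ω ν := by
    rcases hcase with h | ⟨hfin, -, hsup⟩
    · exact exists_isSwept_of_finEnergy hκ hperf hdom hclosed h
    · choose w hw using hexK
      obtain ⟨M, hM, hbound⟩ := hug.exists_energy_le hκ hperf
      refine exists_isSwept_of_forall_compact hκ hperf hclosed hω hw fun K =>
        ENNReal.toReal_mono (ENNReal.mul_ne_top hsup.ne (ENNReal.mul_ne_top hM hfin.ne))
          (hbound K K.2.1 ω hω _ (fun x hx =>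
            le_iSup₂ (f := fun x (_ : x ∈ A) => potential κ ω x) x (K.2.2 hx)) _ (hw K))
  refine ⟨fun σ hσ => ?_, fun K => ?_, ?_⟩
  · obtain ⟨ν, hν⟩ := exists_isSwept_of_finEnergy hκ hperf hdom hclosed hσ
    exact ⟨ν, hν, fun μ hμ => hμ.unique hκ he hσ.1 hν⟩
  · obtain ⟨ν, hν⟩ := hexK K
    exact ⟨ν, hν, fun μ hμ => hμ.unique hκ he hω hν⟩
  obtain ⟨ν, hν⟩ := hexA
  have hint : ∀ τ ∈ FinEnergyOn κ A, ∫⁻ x, potential κ ω x ∂τ = mutualEnergy κ τ ν :=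
    fun τ hτ => by rw [mutualEnergy_eq_lintegral hκ _ hν.1.1.1, hν.lintegral_eq hκ hω hτ]
  have hweak : ∀ μ ∈ FinEnergyOn κ A, (∀ τ ∈ FinEnergyOn κ A,
      ∫⁻ x, potential κ μ x ∂τ = ∫⁻ x, potential κ ω x ∂τ) → μ = ν := fun μ hμ h =>
    eq_of_lintegral_potential_eq hκ he hμ hν.1 fun τ hτ =>
      (h τ hτ).trans (hν.lintegral_eq hκ hω hτ).symm
  -- Completing the square around ν: on ℰ⁺(A) the field acts as pairing with ν.
  have hgauss : ∀ μ ∈ FinEnergyOn κ A, gauss κ ω μ = distSq κ μ ν - pairing κ ν ν := by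
    intro μ hμ
    rw [gauss, hint μ hμ, distSq_eq]
    simp only [pairing, energy]
    ring
  have hνf : ν ∈ FinEnergyField κ A ω :=
    ⟨hν.1, by rw [hint ν hν.1]; exact hν.1.1.2⟩
  have hgν : gauss κ ω ν = - pairing κ ν ν := by
    rw [hgauss ν hν.1, distSq_eq]
    ring
  have hgmin : ∀ τ ∈ FinEnergyField κ A ω, gauss κ ω ν ≤ gauss κ ω τ := fun τ hτ => by
    rw [hgν, hgauss τ hτ.1]
    have := distSq_nonneg he hτ.1.1 hν.1.1
    linarith
  have hginf : (gauss κ ω ν : EReal) = gaussInf κ A ω :=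
    le_antisymm (le_iInf₂ fun τ hτ => EReal.coe_le_coe_iff.2 (hgmin τ hτ)) (iInf₂_le ν hνf)
  have hνΓ : ν ∈ Dominating κ A ω := hν.mem_dominating subset_rfl
  have hpotmin : ∀ μ ∈ Dominating κ A ω, ∀ x, potential κ ν x ≤ potential κ μ x := fun μ hμ =>
    hν.potential_le hκ hdom hω hμ
  have hself : ∀ μ ∈ Dominating κ A ω, energy κ ν ≤ mutualEnergy κ μ ν := fun μ hμ => by
    rw [mutualEnergy_comm hκ hμ.1 hν.1.1.1, mutualEnergy_eq_lintegral hκ _ hμ.1, energy,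
      mutualEnergy_eq_lintegral hκ _ hν.1.1.1]
    exact lintegral_mono (hpotmin μ hμ)
  have hmut : ∀ μ ∈ Dominating κ A ω, mutualEnergy κ μ ν ≤ energy κ μ := fun μ hμ => by
    rw [mutualEnergy_eq_lintegral hκ _ hν.1.1.1, energy, mutualEnergy_eq_lintegral hκ _ hμ.1]
    exact lintegral_mono (hpotmin μ hμ)
  -- In the chain I(ν) ≤ I(μ, ν) ≤ I(μ), the bound I(μ) ≤ I(ν) forces equality throughout.
  have heq : ∀ μ ∈ Dominating κ A ω, μ ∈ FinEnergy κ → energy κ μ ≤ energy κ ν → μ = ν :=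
    fun μ hμ hμe hle => eq_of_mutualEnergy_eq he hμe hν.1.1
      (le_antisymm (hmut μ hμ) (hle.trans (hself μ hμ)))
      (le_antisymm ((hmut μ hμ).trans hle) (hself μ hμ))
  -- Uniqueness in (ii) follows from its case σ = τ in ℰ⁺(A), where τ is its own balayage.
  refine ⟨ν, fun μ => ⟨fun h => IsSwept.unique hκ he hω h hν, fun h => h ▸ hν⟩,
    fun μ => ⟨fun h => hweak μ h.1 h.2, ?_⟩, fun μ => ⟨fun h => hweak μ h.1 fun τ hτ =>
      h.2 τ hτ.1 τ (isSwept_self hτ), ?_⟩, fun w hw => ?_, fun μ => ⟨fun h => ?_, ?_⟩,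
    ⟨hginf, ?_, ?_⟩, fun μ => ⟨fun h => ?_, ?_⟩, fun μ => ⟨fun h => ?_, ?_⟩⟩
  · rintro rfl
    exact ⟨hν.1, fun τ hτ => hν.lintegral_eq hκ hω hτ⟩
  · rintro rfl
    refine ⟨hν.1, fun σ hσ σA hσA => ?_⟩
    -- Symmetry of sweeping: ∫ U^ω dσA = I(σA, ν) = ∫ U^σA dν = ∫ U^σ dν = ∫ U^ν dσ.
    rw [hint σA hσA.1, mutualEnergy_comm hκ hσA.1.1.1 hν.1.1.1,
      mutualEnergy_eq_lintegral hκ _ hσA.1.1.1, hσA.lintegral_eq hκ hσ.1 hν.1,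
      lintegral_potential_comm hκ hσ.1 hν.1.1.1]
  · have hst := hν.strongTendsto hκ he hω hw
    have hwE : ∀ K, w K ∈ FinEnergy κ := fun K => (hw K).1.1
    have hvag := hst.vagueTendsto hperf.consistency hwE hν.1.1 he
    have huniq : ∀ μ ∈ FinEnergyOn κ A, VagueTendsto w atTop μ → μ = ν := fun μ hμ h =>
      h.eq hμ.1.1 hν.1.1.1 hvag
    refine ⟨fun μ => ⟨fun h => huniq μ h.1 (h.2.vagueTendsto hperf.consistency hwE h.1.1 he), ?_⟩,
      fun μ => ⟨fun h => huniq μ h.1 h.2, ?_⟩, fun μ => ⟨fun h => ?_, ?_⟩⟩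
    · rintro rfl
      exact ⟨hν.1, hst⟩
    · rintro rfl
      exact ⟨hν.1, hvag⟩
    · refine eq_of_lintegral_potential_eq hκ he h.1 hν.1 fun τ _ => lintegral_congr fun x => ?_
      exact tendsto_nhds_unique (h.2 x).2 (hν.tendsto_potential hκ hperf hdom hω hw x)
    · rintro rfl
      exact ⟨hν.1, fun x => ⟨IsSwept.monotone_potential hκ hdom hω hw x,
        hν.tendsto_potential hκ hperf hdom hω hw x⟩⟩
  · have h1 := h.2 ν hνf
    rw [hgν, hgauss μ h.1.1] at h1
    exact eq_of_distSq_nonpos he h.1.1.1 hν.1.1 (by linarith)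
  · rintro rfl
    exact ⟨hνf, hgmin⟩
  · rw [← hginf]
    exact EReal.bot_lt_coe _
  · rw [← hginf, hgν]
    exact_mod_cast neg_nonpos.2 (pairing_nonneg ν ν)
  -- Integrating U^μ ≤ U^ν against μ and then against ν gives I(μ) ≤ I(μ, ν) ≤ I(ν).
  · refine heq μ h.1 h.2.1 ?_
    rw [energy, mutualEnergy_eq_lintegral hκ _ h.1.1]
    refine (lintegral_mono (h.2.2 ν hνΓ)).trans ?_
    rw [lintegral_potential_comm hκ h.1.1 hν.1.1.1, energy,
      mutualEnergy_eq_lintegral hκ _ hν.1.1.1]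
    exact lintegral_mono (h.2.2 ν hνΓ)
  · rintro rfl
    exact ⟨hνΓ, hν.1.1, hpotmin⟩
  · exact heq μ h.1 h.2.1 (h.2.2 ν hνΓ)
  · rintro rfl
    exact ⟨hνΓ, hν.1.1, fun μ hμ => (hself μ hμ).trans (hmut μ hμ)⟩
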